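/- Fix integers $d\ge 1$ and $k\ge 2$, and measure distances in $\mathbb R^d$ either by the $\ell_\infty$ norm or by the Euclidean norm. For $r\in\mathbb R$ let $\tilde F(n,r)$ be the following random $k$-CNF formula on the variables $x_1,\dots,x_n$: place $n$ points, labelled $x_1,\dots,x_n$, independently and uniformly at random in $[0,1]^d$, and for each set of $k$ variables whose points lie in a common closed ball of radius $r$ (with centre in $\mathbb R^d$; for $r<0$ there are no such sets) add one clause on exactly these $k$ variables, its $k$ signs being chosen uniformly among the $2^k$ possibilities, independently for different sets and independently of the points. Let $U(k)$ be the smallest $u$ for which there is an unsatisfiable $k$-CNF formula on $u$ variables (each clause containing $k$ distinct variables) in which no two clauses have the same set of variables. Then $U(k)$ is well defined (such a $u$ exists), and there is a function $g:(0,\infty)\to(0,1)$, which may depend on $d$, $k$ and the norm, such that for every $\gamma>0$ $$\lim_{n\to\infty}\Pr\Bigl[\tilde F\bigl(n,\ \gamma\, n^{-\frac{U(k)}{d\,(U(k)-1)}}\bigr)\text{ is satisfiable}\Bigr]=g(\gamma).$$ Moreover $\lim_{\gamma\to 0^+}g(\gamma)=1$ and $\lim_{\gamma\to\infty}g(\gamma)=0$.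 In particular the threshold for satisfiability is coarse, i.e. not sharp: there is no function $r^*:\mathbb N\to\mathbb R$ such that for every $\epsilon>0$ the probability that $\tilde F(n,r(n))$ is satisfiable tends to $1$ for every $r:\mathbb N\to\mathbb R$ with $r(n)<(1-\epsilon)r^*(n)$ for all $n$, and tends to $0$ for every $r:\mathbb N\to\mathbb R$ with $r(n)>(1+\epsilon)r^*(n)$ for all $n$. -/

import Mathlib

open MeasureTheory Filter Topology
open scoped ENNReal

noncomputable section

namespace GeomSAT

/-- A `k`-clause over the variables `V`: a set of exactly `k` distinct variables, each with a sign
(`true`: the literal `x`, `false`: the literal `¬ x`). -/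
@[ext] structure Clause (V : Type*) (k : ℕ) where
  vars : Finset V
  card_vars : vars.card = k
  sign : vars → Bool

/-- The assignment `τ` makes at least one literal of the clause true. -/
def Clause.SatisfiedBy {V : Type*} {k : ℕ} (c : Clause V k) (τ : V → Bool) : Prop :=
  ∃ v : c.vars, τ v = c.sign v

/-- A `k`-CNF formula (the set of its clauses) is satisfiable. -/
def Satisfiable {V : Type*} {k : ℕ} (F : Set (Clause V k)) : Prop :=
  ∃ τ : V → Bool, ∀ c ∈ F, c.SatisfiedBy τ

/-- No two different clauses of the formula have the same set of variables. -/
def DistinctVarSets {V : Type*} {k : ℕ} (F : Set (Clause V k)) : Prop :=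
  ∀ c ∈ F, ∀ c' ∈ F, c.vars = c'.vars → c = c'

/-- The numbers `u` such that some unsatisfiable `k`-CNF formula on `u` variables has clauses with
pairwise distinct variable sets. -/
def unsatSizes (k : ℕ) : Set ℕ :=
  {u | ∃ F : Set (Clause (Fin u) k), DistinctVarSets F ∧ ¬ Satisfiable F}

/-- `U(k)`, the least element of `unsatSizes k`. -/
def U (k : ℕ) : ℕ := sInf (unsatSizes k)

/-- The points `x i`, `i ∈ s`, of `ℝ^d` lie in a common closed ball of radius `r` of the
`ℓ_p` norm. -/
def InCommonBall {d n : ℕ} (p : ℝ≥0∞) [Fact (1 ≤ p)] (r : ℝ) (x : Fin n → Fin d → ℝ)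
    (s : Finset (Fin n)) : Prop :=
  ∃ c : PiLp p (fun _ : Fin d => ℝ), ∀ i ∈ s, WithLp.toLp p (x i) ∈ Metric.closedBall c r

/-- A choice of signs for every set of `k` of the `n` variables. -/
abbrev Signs (n k : ℕ) : Type :=
  (s : {s : Finset (Fin n) // s.card = k}) → (s.1 → Bool)

/-- The formula given by the positions `x` of the `n` variables and the signs `σ`: one clause for
each set of `k` variables in a common ball of radius `r`. -/
def formula {d n k : ℕ} (p : ℝ≥0∞) [Fact (1 ≤ p)] (r : ℝ) (x : Fin n → Fin d → ℝ)
    (σ : Signs n k) : Set (Clause (Fin n) k) :=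
  {c | InCommonBall p r x c.vars ∧ c.sign = σ ⟨c.vars, c.card_vars⟩}

/-- `n` independent uniform points of the cube `[0,1]^d`. -/
def pointsLaw (d n : ℕ) : Measure (Fin n → Fin d → ℝ) :=
  Measure.pi fun _ => (volume : Measure (Fin d → ℝ)).restrict (Set.Icc 0 1)

/-- Independently for each set of `k` variables, a uniform choice among the `2^k` sign patterns. -/
def signsLaw (n k : ℕ) : Measure (Signs n k) :=
  Measure.pi fun s => (PMF.uniformOfFintype (s.1 → Bool)).toMeasure

/-- The probability that the random formula `F̃(n, r)` is satisfiable. The positions and the signs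
are independent. -/
def probSat (p : ℝ≥0∞) [Fact (1 ≤ p)] (d k n : ℕ) (r : ℝ) : ℝ :=
  ((pointsLaw d n).prod (signsLaw n k)).real {ω | Satisfiable (formula p r ω.1 ω.2)}

/-- Satisfiability of `F̃(n, r)` has a sharp threshold in the radius. -/
def HasSharpThreshold (p : ℝ≥0∞) [Fact (1 ≤ p)] (d k : ℕ) : Prop :=
  ∃ rstar : ℕ → ℝ, ∀ ε > 0,
    (∀ r : ℕ → ℝ, (∀ n, r n < (1 - ε) * rstar n) →
      Tendsto (fun n => probSat p d k n (r n)) atTop (𝓝 1)) ∧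
    (∀ r : ℕ → ℝ, (∀ n, (1 + ε) * rstar n < r n) →
      Tendsto (fun n => probSat p d k n (r n)) atTop (𝓝 0))

end GeomSAT

end

/-!
At radius `r`, the expected number of sets of `m` points lying close together is of order
`n ^ m * r ^ (d * (m - 1))`. An unsatisfiable formula with distinct variable sets has at least
`U = U k` variables, and a minimal unsatisfiable part of the random formula is spatially connected,
so that it contains, for every `j` up to its size, `j` points in a ball of radius `O(j r)`
(`linked_of_minimal`, `Linked.exists_subset`). For `r = γ * n ^ (-U / (d * (U - 1)))` there are
boundedly many clusters of `U` points in expectation, while clusters of `U + 1` points disappear.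
So, up to probability `o(1)`, the formula is unsatisfiable exactly when the clauses on some set of
`U` variables are contradictory (`exists_cluster_of_not_satisfiable`, `abs_probSat_sub_le`).

The number of such contradictory `U`-sets is asymptotically Poisson. Events of disjoint sets are
independent, and two different overlapping contradictory sets produce a cluster of `U + 1` points,
so Stein's method applies. Only the probability of the value zero is needed, for which the solution
of the Stein equation is the integral of `t ^ w * exp (-L t)` over `[0, 1]`
(`abs_measureReal_compl_iUnion_sub_exp_le`).

The probability that `U` given variables are contradictory is computed by placing the first point
and rescaling the others by `r` around it. Divided by `r ^ (d * (U - 1))`, it converges to an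
integral over the shapes of configurations of `U` points (`tendsto_probUnsat_div`), which is finite
because contradictory configurations are bounded, and positive because the formula with all
`k`-subsets of `U` variables is unsatisfiable for some signs (`shapeIntegral_pos`). Hence the limit
is `g γ = exp (-c * γ ^ (d * (U - 1)))` with `c > 0`. As `g` takes values strictly between `0` and
`1` at `γ = 1` and at `γ = 4`, no sharp threshold exists (`not_hasSharpThreshold`).
-/

namespace GeomSAT

/-! ### Restricting a formula to a set of variables -/

/-- The clauses of `formula p r x σ` whose variables all lie in `S` can be satisfied
simultaneously. -/
def SatOn {d n k : ℕ} (p : ℝ≥0∞) [Fact (1 ≤ p)] (r : ℝ) (x : Fin n → Fin d → ℝ)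
    (σ : Signs n k) (S : Finset (Fin n)) : Prop :=
  ∃ τ : Fin n → Bool, ∀ s : {s : Finset (Fin n) // s.card = k}, s.1 ⊆ S →
    InCommonBall p r x s.1 → ∃ v : s.1, τ v = σ s v

lemma satisfiable_formula_iff {d n k : ℕ} {p : ℝ≥0∞} [Fact (1 ≤ p)] {r : ℝ}
    {x : Fin n → Fin d → ℝ} {σ : Signs n k} :
    Satisfiable (formula p r x σ) ↔ SatOn p r x σ Finset.univ := by
  constructor
  · rintro ⟨τ, h⟩
    exact ⟨τ, fun s _ hs => h ⟨s.1, s.2, σ s⟩ ⟨hs, rfl⟩⟩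
  · rintro ⟨τ, h⟩
    refine ⟨τ, ?_⟩
    rintro ⟨s, hs, sg⟩ ⟨hb, hsg⟩
    obtain ⟨v, hv⟩ := h ⟨s, hs⟩ (Finset.subset_univ _) hb
    exact ⟨v, hv.trans (congrFun hsg v).symm⟩

lemma SatOn.mono {d n k : ℕ} {p : ℝ≥0∞} [Fact (1 ≤ p)] {r : ℝ} {x : Fin n → Fin d → ℝ}
    {σ : Signs n k} {S T : Finset (Fin n)} (h : SatOn p r x σ T) (hST : S ⊆ T) :
    SatOn p r x σ S := by
  obtain ⟨τ, hτ⟩ := h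
  exact ⟨τ, fun s hs => hτ s (hs.trans hST)⟩

/-- The image of a `k`-set under an embedding, as a `k`-set. -/
def edgeMap {m n k : ℕ} (e : Fin m ↪ Fin n) (s : {s : Finset (Fin m) // s.card = k}) :
    {s : Finset (Fin n) // s.card = k} :=
  ⟨s.1.map e, by rw [Finset.card_map, s.2]⟩

lemma edgeMap_injective {m n k : ℕ} (e : Fin m ↪ Fin n) :
    Function.Injective (edgeMap (k := k) e) := fun _ _ h =>
  Subtype.ext (Finset.map_injective e (congrArg Subtype.val h))

/-- The signs on the `k`-subsets of `Fin m` obtained by renaming the variables along an embedding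
`Fin m ↪ Fin n`. -/
def pullSigns {m n k : ℕ} (e : Fin m ↪ Fin n) (σ : Signs n k) : Signs m k :=
  fun s v => σ (edgeMap e s) ⟨e v, Finset.mem_map_of_mem e v.2⟩

lemma inCommonBall_comp {d m n : ℕ} {p : ℝ≥0∞} [Fact (1 ≤ p)] {r : ℝ}
    {x : Fin n → Fin d → ℝ} (e : Fin m ↪ Fin n) (s : Finset (Fin m)) :
    InCommonBall p r (x ∘ e) s ↔ InCommonBall p r x (s.map e) := by
  simp [InCommonBall]

lemma satOn_map_iff {d m n k : ℕ} {p : ℝ≥0∞} [Fact (1 ≤ p)] {r : ℝ}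
    {x : Fin n → Fin d → ℝ} {σ : Signs n k} (e : Fin m ↪ Fin n) :
    SatOn p r x σ (Finset.univ.map e) ↔ Satisfiable (formula p r (x ∘ e) (pullSigns e σ)) := by
  rw [satisfiable_formula_iff]
  constructor
  · rintro ⟨τ, h⟩
    refine ⟨τ ∘ e, fun s _ hs => ?_⟩
    obtain ⟨⟨v, hv⟩, h1⟩ := h (edgeMap e s) (Finset.map_subset_map.2 (Finset.subset_univ _))
      ((inCommonBall_comp e s.1).1 hs)
    obtain ⟨w, hw, rfl⟩ := Finset.mem_map.1 hv
    exact ⟨⟨w, hw⟩, h1⟩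
  · rintro ⟨τ, h⟩
    refine ⟨Function.extend e τ fun _ => false, ?_⟩
    rintro ⟨s, hk⟩ hs hb
    obtain ⟨t, -, rfl⟩ := Finset.subset_map_iff.1 hs
    obtain ⟨⟨w, hw⟩, h1⟩ := h ⟨t, by simpa using hk⟩ (Finset.subset_univ _)
      ((inCommonBall_comp e t).2 hb)
    refine ⟨⟨e w, Finset.mem_map_of_mem e hw⟩, ?_⟩
    rw [e.injective.extend_apply]
    exact h1

lemma formula_distinctVarSets {d n k : ℕ} {p : ℝ≥0∞} [Fact (1 ≤ p)] {r : ℝ}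
    {x : Fin n → Fin d → ℝ} {σ : Signs n k} : DistinctVarSets (formula p r x σ) := by
  rintro ⟨s, hs, sg⟩ ⟨-, h⟩ ⟨s', hs', sg'⟩ ⟨-, h'⟩ (rfl : s = s')
  simp only at h h'
  rw [h, h']

lemma U_le_of_not_satisfiable {d n k : ℕ} {p : ℝ≥0∞} [Fact (1 ≤ p)] {r : ℝ}
    {x : Fin n → Fin d → ℝ} {σ : Signs n k} (h : ¬ Satisfiable (formula p r x σ)) : U k ≤ n :=
  Nat.sInf_le ⟨_, formula_distinctVarSets, h⟩

lemma U_le_card_of_not_satOn {d n k : ℕ} {p : ℝ≥0∞} [Fact (1 ≤ p)] {r : ℝ}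
    {x : Fin n → Fin d → ℝ} {σ : Signs n k} {S : Finset (Fin n)} (h : ¬ SatOn p r x σ S) :
    U k ≤ S.card := by
  have hS : Finset.univ.map (S.orderEmbOfFin rfl).toEmbedding = S := by
    simp
  rw [← hS, satOn_map_iff] at h
  exact U_le_of_not_satisfiable h

/-! ### Minimal unsatisfiable sets of variables are spatially linked -/

/-- Every partition of `S` into two nonempty parts is crossed by a pair of points at distance at
most `δ`; equivalently, the graph on `S` joining points at distance at most `δ` is connected. -/
def Linked {n d : ℕ} (δ : ℝ) (x : Fin n → Fin d → ℝ) (S : Finset (Fin n)) : Prop :=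
  ∀ A ⊆ S, A.Nonempty → A ≠ S → ∃ a ∈ A, ∃ b ∈ S \ A, dist (x a) (x b) ≤ δ

lemma InCommonBall.dist_le {d n : ℕ} {p : ℝ≥0∞} [Fact (1 ≤ p)] {r : ℝ}
    {x : Fin n → Fin d → ℝ} {s : Finset (Fin n)} (h : InCommonBall p r x s) {a b : Fin n}
    (ha : a ∈ s) (hb : b ∈ s) : dist (x a) (x b) ≤ 2 * r := by
  obtain ⟨c, hc⟩ := h
  have h1 : dist (x a) (x b) ≤ dist (WithLp.toLp p (x a)) (WithLp.toLp p (x b)) := by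
    simpa using (PiLp.lipschitzWith_ofLp p (fun _ : Fin d => ℝ)).dist_le_mul
      (WithLp.toLp p (x a)) (WithLp.toLp p (x b))
  have h2 := dist_triangle_right (WithLp.toLp p (x a)) (WithLp.toLp p (x b)) c
  have h3 := hc a ha
  have h4 := hc b hb
  rw [Metric.mem_closedBall] at h3 h4
  linarith

/-- If no clause crosses the cut `A`, `S \ A`, then assignments satisfying the two parts glue
together. -/
lemma linked_of_minimal {d n k : ℕ} {p : ℝ≥0∞} [Fact (1 ≤ p)] {r : ℝ}
    {x : Fin n → Fin d → ℝ} {σ : Signs n k} {S : Finset (Fin n)} (h : ¬ SatOn p r x σ S)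
    (hmin : ∀ T ⊂ S, SatOn p r x σ T) : Linked (2 * r) x S := by
  intro A hAS hA hne
  by_contra! hcut
  obtain ⟨τ₁, h₁⟩ := hmin A (hAS.ssubset_of_ne hne)
  obtain ⟨τ₂, h₂⟩ := hmin (S \ A) (Finset.sdiff_ssubset hAS hA)
  refine h ⟨fun v => if v ∈ A then τ₁ v else τ₂ v, fun s hs hb => ?_⟩
  by_cases hsA : s.1 ⊆ A
  · obtain ⟨v, hv⟩ := h₁ s hsA hb
    exact ⟨v, by simpa [hsA v.2] using hv⟩
  · obtain ⟨b, hbs, hbA⟩ := Finset.not_subset.1 hsA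
    have hd : ∀ v ∈ s.1, v ∉ A := fun v hv hvA =>
      absurd (hb.dist_le hv hbs) (not_le.2 (hcut v hvA b (Finset.mem_sdiff.2 ⟨hs hbs, hbA⟩)))
    obtain ⟨v, hv⟩ := h₂ s (fun v hv => Finset.mem_sdiff.2 ⟨hs hv, hd v hv⟩) hb
    exact ⟨v, by simpa [hd v v.2] using hv⟩

lemma linked_of_card_eq_U {d n k : ℕ} {p : ℝ≥0∞} [Fact (1 ≤ p)] {r : ℝ}
    {x : Fin n → Fin d → ℝ} {σ : Signs n k} {S : Finset (Fin n)} (h : ¬ SatOn p r x σ S)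
    (hS : S.card = U k) : Linked (2 * r) x S := by
  refine linked_of_minimal h fun T hT => ?_
  by_contra hT'
  have := U_le_card_of_not_satOn hT'
  have := Finset.card_lt_card hT
  omega

/-- A linked set contains subsets of every smaller size around each of its points, whose radius
grows at most linearly with their size. -/
lemma Linked.exists_subset {n d : ℕ} {δ : ℝ} {x : Fin n → Fin d → ℝ} {S : Finset (Fin n)}
    (h : Linked δ x S) {i : Fin n} (hi : i ∈ S) (j : ℕ) (hj : j + 1 ≤ S.card) :
    ∃ T ⊆ S, i ∈ T ∧ T.card = j + 1 ∧ ∀ a ∈ T, dist (x a) (x i) ≤ j * δ := by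
  induction j with
  | zero => exact ⟨{i}, by simpa using hi, by simp, by simp, by simp⟩
  | succ j ih =>
    obtain ⟨T, hTS, hiT, hc, hT⟩ := ih (by omega)
    obtain ⟨a, ha, b, hb, hab⟩ := h T hTS ⟨i, hiT⟩ (by rintro rfl; omega)
    obtain ⟨hbS, hbT⟩ := Finset.mem_sdiff.1 hb
    have hδ : 0 ≤ δ := dist_nonneg.trans hab
    refine ⟨insert b T, Finset.insert_subset hbS hTS, Finset.mem_insert_of_mem hiT,
      by rw [Finset.card_insert_of_notMem hbT, hc], ?_⟩
    intro c hc'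
    push_cast
    rcases Finset.mem_insert.1 hc' with rfl | hc'
    · have := dist_triangle_left (x c) (x i) (x a)
      have := hT a ha
      linarith
    · have := hT c hc'
      linarith

lemma Linked.dist_le {n d : ℕ} {δ : ℝ} {x : Fin n → Fin d → ℝ} {S : Finset (Fin n)}
    (h : Linked δ x S) (hδ : 0 ≤ δ) {i a : Fin n} (hi : i ∈ S) (ha : a ∈ S) :
    dist (x a) (x i) ≤ S.card * δ := by
  have hpos : 0 < S.card := Finset.card_pos.2 ⟨i, hi⟩
  obtain ⟨T, hTS, -, hc, hT⟩ := h.exists_subset hi (S.card - 1) (by omega)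
  obtain rfl : T = S := Finset.eq_of_subset_of_card_le hTS (by omega)
  refine (hT a ha).trans (mul_le_mul_of_nonneg_right ?_ hδ)
  exact_mod_cast Nat.sub_le _ _

/-- An unsatisfiable formula without an unsatisfiable part on `U k` variables has a minimal
unsatisfiable part on more variables, hence a cluster of `U k + 1` points. -/
lemma exists_cluster_of_not_satisfiable {d n k : ℕ} {p : ℝ≥0∞} [Fact (1 ≤ p)] {r : ℝ}
    {x : Fin n → Fin d → ℝ} {σ : Signs n k} (hU : 0 < U k)
    (h : ¬ Satisfiable (formula p r x σ))
    (hU' : ∀ S : Finset (Fin n), S.card = U k → SatOn p r x σ S) :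
    ∃ T : Finset (Fin n), T.card = U k + 1 ∧
      ∀ a ∈ T, ∀ b ∈ T, dist (x a) (x b) ≤ 4 * U k * r := by
  rw [satisfiable_formula_iff] at h
  obtain ⟨S, -, hS⟩ := exists_minimal_le_of_wellFoundedLT (fun S => ¬ SatOn p r x σ S) _ h
  have hlink : Linked (2 * r) x S := linked_of_minimal hS.prop fun T hT => by
    by_contra hT'
    exact hT.not_subset (hS.le_of_le hT' hT.subset)
  have hcard := U_le_card_of_not_satOn hS.prop
  have hne : S.card ≠ U k := fun hc => hS.prop (hU' S hc)
  obtain ⟨i, hi⟩ : S.Nonempty := Finset.card_pos.1 (by omega)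
  obtain ⟨T, -, -, hc, hT⟩ := hlink.exists_subset hi (U k) (by omega)
  refine ⟨T, hc, fun a ha b hb => ?_⟩
  have := dist_triangle_right (x a) (x b) (x i)
  have := hT a ha
  have := hT b hb
  linarith

/-- Two different unsatisfiable sets of `U k` variables with a common variable produce a cluster of
`U k + 1` points that contains the first of them. -/
lemma exists_cluster_of_overlap {d n k : ℕ} {p : ℝ≥0∞} [Fact (1 ≤ p)] {r : ℝ}
    (hr : 0 ≤ r) {x : Fin n → Fin d → ℝ} {σ : Signs n k} {S T : Finset (Fin n)}
    (hS : ¬ SatOn p r x σ S) (hT : ¬ SatOn p r x σ T) (hSc : S.card = U k) (hTc : T.card = U k)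
    (hne : T ≠ S) (hST : ¬ Disjoint S T) :
    ∃ v ∉ S, ∀ a ∈ insert v S, ∀ b ∈ insert v S, dist (x a) (x b) ≤ 4 * U k * r := by
  obtain ⟨i, hiS, hiT⟩ := Finset.not_disjoint_iff.1 hST
  obtain ⟨v, hvT, hvS⟩ : ∃ v ∈ T, v ∉ S := by
    by_contra! hsub
    exact hne (Finset.eq_of_subset_of_card_le hsub (by omega))
  have key : ∀ a ∈ insert v S, dist (x a) (x i) ≤ U k * (2 * r) := by
    intro a ha
    rcases Finset.mem_insert.1 ha with rfl | ha
    · exact hTc ▸ (linked_of_card_eq_U hT hTc).dist_le (by positivity) hiT hvT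
    · exact hSc ▸ (linked_of_card_eq_U hS hSc).dist_le (by positivity) hiS ha
  refine ⟨v, hvS, fun a ha b hb => ?_⟩
  have := dist_triangle_right (x a) (x b) (x i)
  have := key a ha
  have := key b hb
  linarith

/-! ### Unsatisfiable formulas with distinct variable sets exist -/

/-- There is an unsatisfiable formula with clause set `I` in which clause `i` has the variable set
`f i` of size `k`, these sets being different, and the signs `sg i` (whose values off `f i` are
irrelevant). -/
def HasUnsatFamily (V I : Type) (k : ℕ) : Prop :=
  ∃ (f : I → Finset V) (sg : I → V → Bool), Function.Injective f ∧ (∀ i, (f i).card = k) ∧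
    ∀ τ : V → Bool, ∃ i, ∀ v ∈ f i, τ v ≠ sg i v

/-- The implications `x₀ → x₁ → x₂ → ¬x₀ → x₃ → x₄ → x₀` cannot hold together, and they use six
different pairs of variables. -/
lemma hasUnsatFamily_two : HasUnsatFamily (Fin 5) (Fin 6) 2 := by
  refine ⟨![{0, 1}, {1, 2}, {0, 2}, {0, 3}, {3, 4}, {0, 4}],
    ![![false, true, false, false, false], ![false, false, true, false, false],
      ![false, false, false, false, false], ![true, false, false, true, false],
      ![false, false, false, false, true], ![true, false, false, false, false]], ?_, ?_, ?_⟩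
  · decide
  · decide
  · decide

/-- Two disjoint copies of an unsatisfiable formula, one with a new literal `y` added to each
clause and the other with `¬y`, form an unsatisfiable formula with clauses longer by one. -/
lemma HasUnsatFamily.succ {V I : Type} {k : ℕ} (h : HasUnsatFamily V I k) (hk : 0 < k) :
    HasUnsatFamily (Option (V ⊕ V)) (I ⊕ I) (k + 1) := by
  obtain ⟨f, sg, hf, hc, hu⟩ := h
  refine ⟨Sum.elim (fun i => Finset.insertNone ((f i).map Function.Embedding.inl))
      (fun i => Finset.insertNone ((f i).map Function.Embedding.inr)),
    Sum.elim (fun i v => v.elim true (Sum.elim (sg i) (sg i)))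
      (fun i v => v.elim false (Sum.elim (sg i) (sg i))), ?_, ?_, ?_⟩
  · have hdisj : ∀ i j, Finset.insertNone ((f i).map Function.Embedding.inl)
        ≠ Finset.insertNone ((f j).map (Function.Embedding.inr : V ↪ V ⊕ V)) := by
      intro i j hij
      obtain ⟨v, hv⟩ : (f i).Nonempty := Finset.card_pos.1 (by rw [hc]; exact hk)
      have : some (Sum.inl v) ∈
          Finset.insertNone ((f i).map (Function.Embedding.inl : V ↪ V ⊕ V)) := by
        simp [hv]
      rw [hij] at this
      simp at this
    rintro (i | i) (j | j) hij
    · exact congrArg _ (hf (Finset.map_injective _ (Finset.insertNone.injective hij)))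
    · exact absurd hij (hdisj i j)
    · exact absurd hij.symm (hdisj j i)
    · exact congrArg _ (hf (Finset.map_injective _ (Finset.insertNone.injective hij)))
  · rintro (i | i) <;> simp [hc]
  · intro τ
    cases hτ : τ none with
    | false =>
      obtain ⟨i, hi⟩ := hu fun v => τ (some (Sum.inl v))
      refine ⟨Sum.inl i, ?_⟩
      rintro (_ | v | v) hv
      · simp [hτ]
      · exact hi v (by simpa using hv)
      · simp at hv
    | true =>
      obtain ⟨i, hi⟩ := hu fun v => τ (some (Sum.inr v))
      refine ⟨Sum.inr i, ?_⟩
      rintro (_ | v | v) hv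
      · simp [hτ]
      · simp at hv
      · exact hi v (by simpa using hv)

lemma exists_hasUnsatFamily {k : ℕ} (hk : 2 ≤ k) :
    ∃ (V I : Type) (_ : Fintype V), HasUnsatFamily V I k := by
  induction k, hk using Nat.le_induction with
  | base => exact ⟨_, _, inferInstance, hasUnsatFamily_two⟩
  | succ k hk ih =>
    obtain ⟨V, I, _, h⟩ := ih
    exact ⟨_, _, inferInstance, h.succ (by omega)⟩

lemma unsatSizes_nonempty {k : ℕ} (hk : 2 ≤ k) : (unsatSizes k).Nonempty := by
  obtain ⟨V, I, _, f, sg, hf, hc, hu⟩ := exists_hasUnsatFamily hk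
  let e : V ≃ Fin (Fintype.card V) := Fintype.equivFin V
  refine ⟨Fintype.card V, Set.range fun i => (⟨(f i).map e.toEmbedding, by simp [hc],
    fun v => sg i (e.symm v)⟩ : Clause _ k), ?_, ?_⟩
  · rintro _ ⟨i, rfl⟩ _ ⟨j, rfl⟩ h
    rw [hf (Finset.map_injective _ h)]
  · rintro ⟨τ, hτ⟩
    obtain ⟨i, hi⟩ := hu (τ ∘ e)
    obtain ⟨⟨v, hv⟩, h⟩ := hτ _ ⟨i, rfl⟩
    obtain ⟨w, hw, rfl⟩ := Finset.mem_map.1 hv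
    exact hi w hw (by simpa using h)

lemma le_U {k : ℕ} (hk : 2 ≤ k) : k ≤ U k := by
  obtain ⟨F, -, hF⟩ := Nat.sInf_mem (unsatSizes_nonempty hk)
  by_contra hlt
  refine hF ⟨fun _ => true, fun c _ => ?_⟩
  have h := Finset.card_le_univ c.vars
  rw [Fintype.card_fin, c.card_vars] at h
  exact absurd h hlt

/-- Signs that make the formula with all `k`-subsets of `U k` variables unsatisfiable. -/
lemma exists_signs_not_satisfiable {d k : ℕ} (hk : 2 ≤ k) {p : ℝ≥0∞} [Fact (1 ≤ p)] {r : ℝ} :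
    ∃ σ : Signs (U k) k, ∀ x : Fin (U k) → Fin d → ℝ, InCommonBall p r x Finset.univ →
      ¬ Satisfiable (formula p r x σ) := by
  classical
  obtain ⟨F, hd, hF⟩ := Nat.sInf_mem (unsatSizes_nonempty hk)
  change Set (Clause (Fin (U k)) k) at F
  have hg : ∀ s : {s : Finset (Fin (U k)) // s.card = k}, ∃ g : s.1 → Bool,
      ∀ c ∈ F, c.vars = s.1 → c = ⟨s.1, s.2, g⟩ := by
    rintro ⟨s, hs⟩
    by_cases h : ∃ c ∈ F, c.vars = s
    · obtain ⟨⟨s', hs', g⟩, hc, rfl⟩ := h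
      exact ⟨g, fun c' hc' h' => hd c' hc' _ hc h'⟩
    · exact ⟨fun _ => true, fun c hc h' => absurd ⟨c, hc, h'⟩ h⟩
  choose σ hσ using hg
  refine ⟨σ, fun x hx => ?_⟩
  rintro ⟨τ, hτ⟩
  refine hF ⟨τ, fun c hc => hτ c ⟨?_, ?_⟩⟩
  · obtain ⟨z, hz⟩ := hx
    exact ⟨z, fun i _ => hz i (Finset.mem_univ i)⟩
  · have := hσ ⟨c.vars, c.card_vars⟩ c hc rfl
    exact eq_of_heq ((Clause.ext_iff.1 this).2)

/-! ### Poisson approximation for locally dependent events -/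

/-- The bounded solution, shifted by one, of the Stein equation of the Poisson law with mean `L` for
the event `{0}`. -/
noncomputable def steinSol (L : ℝ) (w : ℕ) : ℝ :=
  ∫ t in (0 : ℝ)..1, t ^ w * Real.exp (-(L * t))

lemma steinSol_nonneg (L : ℝ) (w : ℕ) : 0 ≤ steinSol L w :=
  intervalIntegral.integral_nonneg zero_le_one fun _ ht =>
    mul_nonneg (pow_nonneg ht.1 _) (Real.exp_nonneg _)

lemma steinSol_le_one {L : ℝ} (hL : 0 ≤ L) (w : ℕ) : steinSol L w ≤ 1 := by
  have : steinSol L w ≤ ∫ _ in (0 : ℝ)..1, (1 : ℝ) := by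
    refine intervalIntegral.integral_mono_on zero_le_one
      (Continuous.intervalIntegrable (by fun_prop) _ _) (by simp) fun t ht => ?_
    refine mul_le_one₀ (pow_le_one₀ ht.1 ht.2) (Real.exp_nonneg _) ?_
    rw [Real.exp_le_one_iff, neg_nonpos]
    exact mul_nonneg hL ht.1
  simpa using this

lemma abs_steinSol_sub_le {L : ℝ} (hL : 0 ≤ L) (v w : ℕ) :
    |steinSol L v - steinSol L w| ≤ 1 := by
  have h1 := steinSol_nonneg L v
  have h2 := steinSol_nonneg L w
  have h3 := steinSol_le_one hL v
  have h4 := steinSol_le_one hL w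
  rw [abs_le]
  constructor <;> linarith

/-- Stein's equation, by integrating the derivative of `t ^ w * exp (-L t)` over `[0, 1]`. -/
lemma steinSol_equation (L : ℝ) (w : ℕ) :
    L * steinSol L w - w * steinSol L (w - 1) = 0 ^ w - Real.exp (-L) := by
  have hd : ∀ t ∈ Set.uIcc (0 : ℝ) 1, HasDerivAt (fun t : ℝ => -(t ^ w * Real.exp (-(L * t))))
      (L * (t ^ w * Real.exp (-(L * t))) - w * (t ^ (w - 1) * Real.exp (-(L * t)))) t := by
    intro t _
    have h1 : HasDerivAt (fun t : ℝ => Real.exp (-(L * t))) (Real.exp (-(L * t)) * (-L)) t := by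
      have := ((hasDerivAt_id t).const_mul L).neg.exp
      simpa using this
    refine ((hasDerivAt_pow w t).fun_mul h1).fun_neg.congr_deriv ?_
    ring
  have h := intervalIntegral.integral_eq_sub_of_hasDerivAt hd
    (Continuous.intervalIntegrable (by fun_prop) _ _)
  rw [intervalIntegral.integral_sub (Continuous.intervalIntegrable (by fun_prop) _ _)
    (Continuous.intervalIntegrable (by fun_prop) _ _), intervalIntegral.integral_const_mul,
    intervalIntegral.integral_const_mul] at h
  simp only [steinSol]
  rw [h]
  simp
  ring

/-- The number of the events `A j`, `j ∈ s`, that occur. -/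
noncomputable def countEvents {Ω ι : Type*} (A : ι → Set Ω) (s : Finset ι) (ω : Ω) : ℕ :=
  ∑ j ∈ s, (A j).indicator (fun _ => 1) ω

lemma measurable_countEvents {Ω ι : Type*} [MeasurableSpace Ω] {A : ι → Set Ω}
    (hA : ∀ i, MeasurableSet (A i)) (s : Finset ι) : Measurable (countEvents A s) :=
  Finset.measurable_fun_sum _ fun j _ => measurable_const.indicator (hA j)

lemma abs_integral_le_of_eqOn_zero {Ω : Type*} [MeasurableSpace Ω] {ν : Measure Ω}
    [IsFiniteMeasure ν] {f : Ω → ℝ} {C : Set Ω} (hC : MeasurableSet C) (hf : ∀ ω, |f ω| ≤ 1)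
    (h0 : ∀ᵐ ω ∂ν, ω ∉ C → f ω = 0) : |∫ ω, f ω ∂ν| ≤ ν.real C := by
  have h : ‖∫ ω, f ω ∂ν‖ ≤ ∫ ω, C.indicator (fun _ => (1 : ℝ)) ω ∂ν := by
    refine norm_integral_le_of_norm_le ((integrable_const _).indicator hC) ?_
    filter_upwards [h0] with ω hω
    by_cases h : ω ∈ C
    · simpa [h] using hf ω
    · simp [h, hω h]
  rwa [integral_indicator_const _ hC, smul_eq_mul, mul_one] at h

/-- Poisson approximation by Stein's method: if `A i` is independent of the number of events
outside its neighbourhood `N i`, then the probability that no event occurs is `exp (-λ)`, with `λ`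
the expected number of events, up to two sums over pairs of neighbours. -/
theorem abs_measureReal_compl_iUnion_sub_exp_le {Ω ι : Type*} [Fintype ι] [DecidableEq ι]
    [MeasurableSpace Ω] {μ : Measure Ω} [IsProbabilityMeasure μ] {A : ι → Set Ω}
    (hA : ∀ i, MeasurableSet (A i)) {N : ι → Finset ι} (hN : ∀ i, i ∈ N i)
    (hind : ∀ i, ∀ h : ℕ → ℝ, (∀ w, |h w| ≤ 1) →
      ∫ ω in A i, h (countEvents A (N i)ᶜ ω) ∂μ =
        μ.real (A i) * ∫ ω, h (countEvents A (N i)ᶜ ω) ∂μ) :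
    |μ.real (⋃ i, A i)ᶜ - Real.exp (-∑ i, μ.real (A i))| ≤
      ∑ i, μ.real (A i) * μ.real (⋃ j ∈ N i, A j) +
      ∑ i, μ.real (A i ∩ ⋃ j ∈ (N i).erase i, A j) := by
  set L := ∑ i, μ.real (A i) with hLdef
  have hL : 0 ≤ L := Finset.sum_nonneg fun i _ => measureReal_nonneg
  set W := countEvents A Finset.univ with hW
  have hWm : Measurable W := measurable_countEvents hA _
  have habs : ∀ w, |steinSol L w| ≤ 1 := fun w => by
    rw [abs_of_nonneg (steinSol_nonneg _ _)]
    exact steinSol_le_one hL w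
  have hint : ∀ (ν : Measure Ω) [IsFiniteMeasure ν] (f : Ω → ℕ), Measurable f →
      Integrable (fun ω => steinSol L (f ω)) ν := fun ν _ f hf =>
    Integrable.of_bound ((measurable_of_countable (steinSol L)).comp hf).aestronglyMeasurable 1
      (Eventually.of_forall fun ω => habs _)
  have hunion : ∀ s : Finset ι, MeasurableSet (⋃ j ∈ s, A j) := fun s =>
    s.measurableSet_biUnion fun j _ => hA j
  -- Stein's equation at `W`, integrated.
  have hpoint : ∀ ω, ((⋃ i, A i)ᶜ).indicator (fun _ => (1 : ℝ)) ω - Real.exp (-L) =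
      ∑ i, (μ.real (A i) * steinSol L (W ω) -
        (A i).indicator (fun ω => steinSol L (W ω - 1)) ω) := by
    intro ω
    have h0 : ((⋃ i, A i)ᶜ).indicator (fun _ => (1 : ℝ)) ω = 0 ^ W ω := by
      by_cases h : ω ∈ ⋃ i, A i
      · have : W ω ≠ 0 := by
          obtain ⟨i, hi⟩ := Set.mem_iUnion.1 h
          have : (A i).indicator (fun _ => 1) ω ≤ W ω :=
            Finset.single_le_sum (f := fun i => (A i).indicator (fun _ => 1) ω)
              (fun _ _ => Nat.zero_le _) (Finset.mem_univ i)
          rw [Set.indicator_of_mem hi] at this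
          omega
        rw [Set.indicator_of_notMem (Set.notMem_compl_iff.2 h), zero_pow this]
      · have : W ω = 0 := Finset.sum_eq_zero fun i _ =>
          Set.indicator_of_notMem (fun hi => h (Set.mem_iUnion.2 ⟨i, hi⟩)) _
        rw [Set.indicator_of_mem h, this, pow_zero]
    rw [h0, ← steinSol_equation, Finset.sum_sub_distrib, ← Finset.sum_mul]
    congr 1
    rw [hW, countEvents]
    push_cast
    rw [Finset.sum_mul]
    refine Finset.sum_congr rfl fun i _ => ?_
    by_cases hi : ω ∈ A i <;> simp [hi, countEvents]
  have hmain : μ.real (⋃ i, A i)ᶜ - Real.exp (-L) =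
      ∑ i, (μ.real (A i) * ∫ ω, steinSol L (W ω) ∂μ -
        ∫ ω in A i, steinSol L (W ω - 1) ∂μ) := by
    have hU : MeasurableSet (⋃ i, A i)ᶜ := (MeasurableSet.iUnion hA).compl
    have h1 := congrArg (fun f => ∫ ω, f ω ∂μ) (funext hpoint)
    simp only at h1
    rw [integral_sub ((integrable_const _).indicator hU) (integrable_const _),
      integral_indicator_const _ hU, integral_finsetSum] at h1
    · rw [integral_const, probReal_univ, one_smul, smul_eq_mul, mul_one] at h1
      rw [h1]
      refine Finset.sum_congr rfl fun i _ => ?_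
      rw [integral_sub ((hint μ W hWm).const_mul _)
        ((hint μ _ (hWm.sub_const 1)).indicator (hA i)), integral_const_mul,
        integral_indicator (hA i)]
    · exact fun i _ => ((hint μ W hWm).const_mul _).sub
        ((hint μ _ (hWm.sub_const 1)).indicator (hA i))
  rw [hmain, ← Finset.sum_add_distrib]
  refine (Finset.abs_sum_le_sum_abs _ _).trans (Finset.sum_le_sum fun i _ => ?_)
  -- Both comparisons replace `W` by the count `V` of the events that `A i` does not depend on.
  set V := countEvents A (N i)ᶜ with hV
  have hVm : Measurable V := measurable_countEvents hA _
  have hsplit : ∀ ω, W ω = countEvents A (N i) ω + V ω := fun ω =>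
    (Finset.sum_add_sum_compl (N i) _).symm
  have hsplit' : ∀ ω ∈ A i, countEvents A (N i) ω = countEvents A ((N i).erase i) ω + 1 := by
    intro ω hω
    rw [countEvents, ← Finset.sum_erase_add _ _ (hN i), Set.indicator_of_mem hω, countEvents]
  have hzero : ∀ (s : Finset ι), ∀ ω ∉ ⋃ j ∈ s, A j, countEvents A s ω = 0 := fun s ω hω =>
    Finset.sum_eq_zero fun j hj =>
      Set.indicator_of_notMem (fun hωj => hω (Set.mem_biUnion hj hωj)) _
  have e1 : |∫ ω, (steinSol L (W ω) - steinSol L (V ω)) ∂μ| ≤ μ.real (⋃ j ∈ N i, A j) := by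
    refine abs_integral_le_of_eqOn_zero (hunion _) (fun ω => abs_steinSol_sub_le hL _ _)
      (Eventually.of_forall fun ω hω => ?_)
    rw [hsplit, hzero _ ω hω, zero_add, sub_self]
  have e2 : |∫ ω in A i, (steinSol L (V ω) - steinSol L (W ω - 1)) ∂μ| ≤
      μ.real (A i ∩ ⋃ j ∈ (N i).erase i, A j) := by
    have := abs_integral_le_of_eqOn_zero (ν := μ.restrict (A i)) (hunion ((N i).erase i))
      (f := fun ω => steinSol L (V ω) - steinSol L (W ω - 1))
      (fun ω => abs_steinSol_sub_le hL _ _) ?_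
    · rwa [measureReal_restrict_apply (hunion _), Set.inter_comm] at this
    · filter_upwards [ae_restrict_mem (hA i)] with ω hωi hω
      rw [hsplit, hsplit' ω hωi, hzero _ ω hω, zero_add, add_tsub_cancel_left, sub_self]
  have hkey : μ.real (A i) * ∫ ω, steinSol L (W ω) ∂μ - ∫ ω in A i, steinSol L (W ω - 1) ∂μ =
      μ.real (A i) * ∫ ω, (steinSol L (W ω) - steinSol L (V ω)) ∂μ +
      ∫ ω in A i, (steinSol L (V ω) - steinSol L (W ω - 1)) ∂μ := by
    rw [integral_sub (hint μ W hWm) (hint μ V hVm), integral_sub (hint _ V hVm)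
      (hint _ _ (hWm.sub_const 1)), hind i _ habs]
    ring
  rw [hkey]
  refine (abs_add_le _ _).trans (add_le_add ?_ e2)
  rw [abs_mul, abs_of_nonneg measureReal_nonneg]
  exact mul_le_mul_of_nonneg_left e1 measureReal_nonneg

/-! ### Product measures: renaming coordinates and independence -/

/-- Renaming the coordinates of a product measure along an injection, and transforming each of
them, gives a product measure. -/
lemma measurePreserving_pi_comp {I J : Type*} [Fintype I] [Fintype J] {α : I → Type*}
    {β : J → Type*} [∀ i, MeasurableSpace (α i)] [∀ j, MeasurableSpace (β j)]
    {μ : ∀ i, Measure (α i)} {ν : ∀ j, Measure (β j)} [∀ i, IsProbabilityMeasure (μ i)]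
    [∀ j, IsProbabilityMeasure (ν j)] {e : I → J} (he : Function.Injective e)
    {g : ∀ i, β (e i) → α i} (hg : ∀ i, MeasurePreserving (g i) (ν (e i)) (μ i)) :
    MeasurePreserving (fun (y : ∀ j, β j) i => g i (y (e i))) (Measure.pi ν) (Measure.pi μ) := by
  have hm : ∀ i, Measurable fun y : ∀ j, β j => g i (y (e i)) := fun i =>
    (hg i).measurable.comp (measurable_pi_apply _)
  refine ⟨measurable_pi_lambda _ hm, ?_⟩
  have h1 : ProbabilityTheory.iIndepFun (fun j (y : ∀ j, β j) => y j) (Measure.pi ν) :=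
    ProbabilityTheory.iIndepFun_pi (X := fun j (b : β j) => b) fun j => aemeasurable_id
  have h2 := (h1.precomp he).comp g fun i => (hg i).measurable
  have h3 := (ProbabilityTheory.iIndepFun_iff_map_fun_eq_pi_map
    (fun i => (hm i).aemeasurable)).1 h2
  refine h3.trans ?_
  congr with i : 1
  have := ((hg i).comp (measurePreserving_eval ν (e i))).map_eq
  exact this

/-- Functions of complementary sets of coordinates are uncorrelated under a product measure. -/
lemma integral_mul_pi {I : Type*} [Fintype I] {α : I → Type*} [∀ i, MeasurableSpace (α i)]
    {μ : ∀ i, Measure (α i)} [∀ i, IsProbabilityMeasure (μ i)] (P : I → Prop)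
    {f g : (∀ i, α i) → ℝ} (hf : ∀ x y, (∀ i, P i → x i = y i) → f x = f y)
    (hg : ∀ x y, (∀ i, ¬ P i → x i = y i) → g x = g y) :
    ∫ x, f x * g x ∂Measure.pi μ = (∫ x, f x ∂Measure.pi μ) * ∫ x, g x ∂Measure.pi μ := by
  classical
  obtain ⟨b⟩ : Nonempty (∀ i, α i) := (Measure.pi μ).nonempty_of_neZero
  let e := MeasurableEquiv.piEquivPiSubtypeProd α P
  have he : MeasurePreserving e.symm _ _ := (measurePreserving_piEquivPiSubtypeProd μ P).symm
  have hin : ∀ z i (hi : P i), e.symm z i = z.1 ⟨i, hi⟩ := fun z i hi => dif_pos hi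
  have hout : ∀ z i (hi : ¬ P i), e.symm z i = z.2 ⟨i, hi⟩ := fun z i hi => dif_neg hi
  let F : (∀ i : {i // P i}, α i) → ℝ := fun a => f (e.symm (a, fun i => b i))
  let G : (∀ i : {i // ¬ P i}, α i) → ℝ := fun a => g (e.symm (fun i => b i, a))
  have hF : ∀ z, f (e.symm z) = F z.1 := fun z => hf _ _ fun i hi => by simp only [hin _ i hi]
  have hG : ∀ z, g (e.symm z) = G z.2 := fun z => hg _ _ fun i hi => by simp only [hout _ i hi]
  rw [← he.integral_comp' (g := fun x => f x * g x), ← he.integral_comp' (g := f),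
    ← he.integral_comp' (g := g)]
  simp only [hF, hG]
  rw [integral_prod_mul, integral_fun_fst, integral_fun_snd]
  simp

/-- A version of `integral_mul_pi` for a product of two product measures. -/
lemma integral_mul_pi_prod {I J : Type*} [Fintype I] [Fintype J] {α : I → Type*}
    {β : J → Type*} [∀ i, MeasurableSpace (α i)] [∀ j, MeasurableSpace (β j)]
    {μ : ∀ i, Measure (α i)} {ν : ∀ j, Measure (β j)} [∀ i, IsProbabilityMeasure (μ i)]
    [∀ j, IsProbabilityMeasure (ν j)] (P : I → Prop) (Q : J → Prop)
    {f g : (∀ i, α i) × (∀ j, β j) → ℝ}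
    (hfi : Integrable f ((Measure.pi μ).prod (Measure.pi ν)))
    (hgi : Integrable g ((Measure.pi μ).prod (Measure.pi ν)))
    (hfg : Integrable (fun z => f z * g z) ((Measure.pi μ).prod (Measure.pi ν)))
    (hf : ∀ z w, (∀ i, P i → z.1 i = w.1 i) → (∀ j, Q j → z.2 j = w.2 j) → f z = f w)
    (hg : ∀ z w, (∀ i, ¬ P i → z.1 i = w.1 i) → (∀ j, ¬ Q j → z.2 j = w.2 j) → g z = g w) :
    ∫ z, f z * g z ∂(Measure.pi μ).prod (Measure.pi ν) =
      (∫ z, f z ∂(Measure.pi μ).prod (Measure.pi ν)) *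
        ∫ z, g z ∂(Measure.pi μ).prod (Measure.pi ν) := by
  rw [integral_prod _ hfi, integral_prod _ hgi, integral_prod _ hfg]
  have h : ∀ x, ∫ y, f (x, y) * g (x, y) ∂Measure.pi ν =
      (∫ y, f (x, y) ∂Measure.pi ν) * ∫ y, g (x, y) ∂Measure.pi ν := fun x =>
    integral_mul_pi Q (fun y y' h => hf _ _ (fun _ _ => rfl) h)
      (fun y y' h => hg _ _ (fun _ _ => rfl) h)
  simp only [h]
  refine integral_mul_pi P (fun x x' h => ?_) (fun x x' h => ?_)
  · exact congrArg (fun F => ∫ y, F y ∂Measure.pi ν)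
      (funext fun y => hf (x, y) (x', y) h fun _ _ => rfl)
  · exact congrArg (fun F => ∫ y, F y ∂Measure.pi ν)
      (funext fun y => hg (x, y) (x', y) h fun _ _ => rfl)

/-! ### The law of the random formula -/

/-- The joint law of the positions and the signs. -/
noncomputable abbrev law (d n k : ℕ) : Measure ((Fin n → Fin d → ℝ) × Signs n k) :=
  (pointsLaw d n).prod (signsLaw n k)

instance isProbabilityMeasure_cube (d : ℕ) :
    IsProbabilityMeasure ((volume : Measure (Fin d → ℝ)).restrict (Set.Icc 0 1)) :=
  ⟨by rw [Measure.restrict_apply_univ, Real.volume_Icc_pi]; simp⟩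

instance isProbabilityMeasure_pointsLaw (d n : ℕ) : IsProbabilityMeasure (pointsLaw d n) := by
  unfold pointsLaw
  infer_instance

instance isProbabilityMeasure_signsLaw (n k : ℕ) : IsProbabilityMeasure (signsLaw n k) := by
  unfold signsLaw
  infer_instance

lemma measurePreserving_uniform {α β : Type*} [Fintype α] [Nonempty α] [MeasurableSpace α]
    [DiscreteMeasurableSpace α] [Fintype β] [Nonempty β] [MeasurableSpace β]
    [DiscreteMeasurableSpace β] (e : α ≃ β) :
    MeasurePreserving e (PMF.uniformOfFintype α).toMeasure
      (PMF.uniformOfFintype β).toMeasure := by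
  refine ⟨measurable_of_finite _, Measure.ext_of_singleton fun b => ?_⟩
  have h : e ⁻¹' {b} = {e.symm b} := by
    ext a
    simp [Equiv.eq_symm_apply]
  rw [Measure.map_apply (measurable_of_finite _) (measurableSet_singleton b), h,
    PMF.toMeasure_apply_singleton _ _ (measurableSet_singleton _),
    PMF.toMeasure_apply_singleton _ _ (measurableSet_singleton _),
    PMF.uniformOfFintype_apply, PMF.uniformOfFintype_apply, Fintype.card_congr e]

/-- The positions and signs of `m` of the variables, chosen by an embedding. -/
def pull {d m n k : ℕ} (e : Fin m ↪ Fin n) (ω : (Fin n → Fin d → ℝ) × Signs n k) :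
    (Fin m → Fin d → ℝ) × Signs m k :=
  (ω.1 ∘ e, pullSigns e ω.2)

lemma measurePreserving_pull {d m n k : ℕ} (e : Fin m ↪ Fin n) :
    MeasurePreserving (pull (d := d) (k := k) e) (law d n k) (law d m k) := by
  refine MeasurePreserving.prod (f := fun x : Fin n → Fin d → ℝ => x ∘ e)
    (g := pullSigns (k := k) e) ?_ ?_
  · exact measurePreserving_pi_comp e.injective (g := fun _ y => y)
      fun _ => MeasurePreserving.id _
  · refine measurePreserving_pi_comp (β := fun s : {s : Finset (Fin n) // s.card = k} =>
        s.1 → Bool) (α := fun s : {s : Finset (Fin m) // s.card = k} => s.1 → Bool)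
      (edgeMap_injective e)
      (g := fun s (y : (edgeMap e s).1 → Bool) (v : s.1) =>
        y ⟨e v, Finset.mem_map_of_mem e v.2⟩) fun s => ?_
    let E : s.1 ≃ (edgeMap e s).1 := Equiv.ofBijective
      (fun v => ⟨e v, Finset.mem_map_of_mem e v.2⟩)
      ⟨fun a b h => Subtype.ext (e.injective (congrArg Subtype.val h)), by
        rintro ⟨v, hv⟩
        obtain ⟨w, hw, rfl⟩ := Finset.mem_map.1 hv
        exact ⟨⟨w, hw⟩, rfl⟩⟩
    exact measurePreserving_uniform (E.symm.arrowCongr (Equiv.refl Bool))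

/-- Positions in a common ball form a closed set, as the centre can be chosen from a compact set. -/
lemma isClosed_setOf_inCommonBall {d n : ℕ} (p : ℝ≥0∞) [Fact (1 ≤ p)] (r : ℝ)
    (s : Finset (Fin n)) : IsClosed {x : Fin n → Fin d → ℝ | InCommonBall p r x s} := by
  rcases s.eq_empty_or_nonempty with rfl | ⟨i, hi⟩
  · convert isClosed_univ
    ext x
    simp [InCommonBall]
  · refine IsSeqClosed.isClosed fun x y hx hxy => ?_
    have hcont : ∀ j, Tendsto (fun N => WithLp.toLp p (x N j)) atTop (𝓝 (WithLp.toLp p (y j))) :=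
      fun j => ((PiLp.continuous_toLp p _).tendsto _).comp (tendsto_pi_nhds.1 hxy j)
    choose c hc using hx
    obtain ⟨C, hC⟩ := (Metric.isBounded_range_of_tendsto _ (hcont i)).subset_closedBall
      (WithLp.toLp p (y i))
    have hcb : ∀ N, c N ∈ Metric.closedBall (WithLp.toLp p (y i)) (C + r) := by
      intro N
      have h1 := hc N i hi
      have h2 := hC (Set.mem_range_self N)
      rw [Metric.mem_closedBall] at h1 h2 ⊢
      have := dist_triangle_left (c N) (WithLp.toLp p (y i)) (WithLp.toLp p (x N i))
      linarith
    obtain ⟨z, -, φ, hφ, hz⟩ := tendsto_subseq_of_bounded Metric.isBounded_closedBall hcb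
    exact ⟨z, fun j hj => Metric.mem_closedBall.2 <|
      le_of_tendsto (((hcont j).comp hφ.tendsto_atTop).dist hz)
        (Eventually.of_forall fun N => hc (φ N) j hj)⟩

lemma measurableSet_satOn {d n k : ℕ} (p : ℝ≥0∞) [Fact (1 ≤ p)] (r : ℝ) (S : Finset (Fin n)) :
    MeasurableSet {ω : (Fin n → Fin d → ℝ) × Signs n k | SatOn p r ω.1 ω.2 S} := by
  simp only [SatOn, Set.ofPred_exists, Set.ofPred_forall]
  refine MeasurableSet.iUnion fun τ => MeasurableSet.iInter fun s => MeasurableSet.iInter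
    fun _ => MeasurableSet.imp ?_ ?_
  · exact measurable_fst (isClosed_setOf_inCommonBall p r s.1).measurableSet
  · exact measurable_snd (t := {σ : Signs n k | ∃ v : s.1, τ v = σ s v})
      (Set.toFinite _).measurableSet

lemma measurableSet_satisfiable {d n k : ℕ} (p : ℝ≥0∞) [Fact (1 ≤ p)] (r : ℝ) :
    MeasurableSet {ω : (Fin n → Fin d → ℝ) × Signs n k |
      Satisfiable (formula p r ω.1 ω.2)} := by
  simp only [satisfiable_formula_iff]
  exact measurableSet_satOn p r _

/-- The event that the clauses on variables from `S` are contradictory. -/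
def badEvent {d n k : ℕ} (p : ℝ≥0∞) [Fact (1 ≤ p)] (r : ℝ) (S : Finset (Fin n)) :
    Set ((Fin n → Fin d → ℝ) × Signs n k) :=
  {ω | ¬ SatOn p r ω.1 ω.2 S}

lemma measurableSet_badEvent {d n k : ℕ} (p : ℝ≥0∞) [Fact (1 ≤ p)] (r : ℝ)
    (S : Finset (Fin n)) : MeasurableSet (badEvent (d := d) (k := k) p r S) :=
  (measurableSet_satOn p r S).compl

/-- The probability that the formula on `n` variables is unsatisfiable. -/
noncomputable def probUnsat (p : ℝ≥0∞) [Fact (1 ≤ p)] (d k n : ℕ) (r : ℝ) : ℝ :=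
  (law d n k).real {ω | ¬ Satisfiable (formula p r ω.1 ω.2)}

lemma measureReal_badEvent {d n k m : ℕ} (p : ℝ≥0∞) [Fact (1 ≤ p)] (r : ℝ)
    {S : Finset (Fin n)} (hS : S.card = m) :
    (law d n k).real (badEvent p r S) = probUnsat p d k m r := by
  have h := (measurePreserving_pull (d := d) (k := k)
    (S.orderEmbOfFin hS).toEmbedding).measureReal_preimage
    (measurableSet_satisfiable p r).compl.nullMeasurableSet
  rw [probUnsat, ← Set.compl_ofPred, ← h]
  congr 1
  ext ω
  have := satOn_map_iff (p := p) (r := r) (x := ω.1) (σ := ω.2) (S.orderEmbOfFin hS).toEmbedding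
  rw [show Finset.univ.map (S.orderEmbOfFin hS).toEmbedding = S by simp] at this
  exact not_congr this

/-- The events `badEvent p r T` for the sets `T` of `u` variables. -/
def badFamily {d n k : ℕ} (p : ℝ≥0∞) [Fact (1 ≤ p)] (r : ℝ) (u : ℕ)
    (T : {T : Finset (Fin n) // T.card = u}) : Set ((Fin n → Fin d → ℝ) × Signs n k) :=
  badEvent p r T.1

lemma measurableSet_badFamily {d n k : ℕ} (p : ℝ≥0∞) [Fact (1 ≤ p)] (r : ℝ) (u : ℕ)
    (T : {T : Finset (Fin n) // T.card = u}) :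
    MeasurableSet (badFamily (d := d) (k := k) p r u T) :=
  measurableSet_badEvent p r T.1

lemma satOn_congr {d n k : ℕ} {p : ℝ≥0∞} [Fact (1 ≤ p)] {r : ℝ} {S : Finset (Fin n)}
    {ω ω' : (Fin n → Fin d → ℝ) × Signs n k} (h₁ : ∀ i ∈ S, ω.1 i = ω'.1 i)
    (h₂ : ∀ s : {s : Finset (Fin n) // s.card = k}, s.1 ⊆ S → ω.2 s = ω'.2 s) :
    SatOn p r ω.1 ω.2 S ↔ SatOn p r ω'.1 ω'.2 S := by
  refine exists_congr fun τ => forall_congr' fun s => forall_congr' fun hs => ?_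
  rw [h₂ s hs]
  refine imp_congr_left (exists_congr fun c => forall₂_congr fun i hi => ?_)
  rw [h₁ i (hs hi)]

/-- An unsatisfiable part of the formula is independent of the number of unsatisfiable parts among
sets of variables disjoint from it. -/
lemma setIntegral_badEvent_countEvents {d n k u : ℕ} (hk : 0 < k) (p : ℝ≥0∞) [Fact (1 ≤ p)]
    (r : ℝ) (S : Finset (Fin n)) (Ts : Finset {T : Finset (Fin n) // T.card = u})
    (hTs : ∀ T ∈ Ts, Disjoint S T.1) (h : ℕ → ℝ) (hb : ∀ w, |h w| ≤ 1) :
    ∫ ω in badEvent p r S, h (countEvents (badFamily (d := d) (k := k) p r u) Ts ω) ∂law d n k =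
      (law d n k).real (badEvent p r S) *
        ∫ ω, h (countEvents (badFamily (d := d) (k := k) p r u) Ts ω) ∂law d n k := by
  set V := countEvents (badFamily (d := d) (k := k) p r u) Ts with hV
  have hVm : Measurable V := measurable_countEvents (measurableSet_badFamily p r u) Ts
  have hgi : Integrable (fun ω => h (V ω)) (law d n k) :=
    Integrable.of_bound ((measurable_of_countable h).comp hVm).aestronglyMeasurable 1
      (Eventually.of_forall fun ω => hb _)
  have hA := measurableSet_badEvent (d := d) (k := k) p r S
  have hfg : (badEvent p r S).indicator (fun ω => h (V ω)) =
      fun ω => (badEvent p r S).indicator (fun _ => (1 : ℝ)) ω * h (V ω) := by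
    ext ω
    by_cases hω : ω ∈ badEvent p r S <;> simp [hω]
  rw [← integral_indicator hA, ← integral_indicator_one hA, hfg]
  refine integral_mul_pi_prod (· ∈ S) (fun s => s.1 ⊆ S)
    ((integrable_const _).indicator hA) hgi (hfg ▸ hgi.indicator hA) ?_ ?_
  · intro ω ω' h₁ h₂
    have : ω ∈ badEvent p r S ↔ ω' ∈ badEvent p r S := not_congr (satOn_congr h₁ h₂)
    by_cases hω : ω ∈ badEvent p r S
    · rw [Set.indicator_of_mem hω, Set.indicator_of_mem (this.1 hω)]
    · rw [Set.indicator_of_notMem hω, Set.indicator_of_notMem (mt this.2 hω)]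
  · intro ω ω' h₁ h₂
    refine congrArg h (Finset.sum_congr rfl fun T hT => ?_)
    have hd := hTs T hT
    have : ω ∈ badFamily p r u T ↔ ω' ∈ badFamily p r u T := by
      refine not_congr (satOn_congr (fun i hi => h₁ i fun hiS =>
        Finset.disjoint_left.1 hd hiS hi) fun s hs => h₂ s fun hsS => ?_)
      -- A nonempty clause inside `T` cannot also lie inside `S`.
      obtain ⟨v, hv⟩ : s.1.Nonempty := Finset.card_pos.1 (by rw [s.2]; exact hk)
      exact Finset.disjoint_left.1 hd (hsS hv) (hs hv)
    by_cases hω : ω ∈ badFamily p r u T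
    · rw [Set.indicator_of_mem hω, Set.indicator_of_mem (this.1 hω)]
    · rw [Set.indicator_of_notMem hω, Set.indicator_of_notMem (mt this.2 hω)]

/-! ### Unsatisfiability of the formula at given positions -/

/-- The conditional probability, given the positions, that the formula is unsatisfiable. -/
noncomputable def unsatGiven {d u : ℕ} (p : ℝ≥0∞) [Fact (1 ≤ p)] (k : ℕ) (r : ℝ)
    (x : Fin u → Fin d → ℝ) : ℝ :=
  (signsLaw u k).real {σ | ¬ Satisfiable (formula p r x σ)}

lemma unsatGiven_nonneg {d u : ℕ} (p : ℝ≥0∞) [Fact (1 ≤ p)] (k : ℕ) (r : ℝ)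
    (x : Fin u → Fin d → ℝ) : 0 ≤ unsatGiven p k r x := measureReal_nonneg

lemma unsatGiven_le_one {d u : ℕ} (p : ℝ≥0∞) [Fact (1 ≤ p)] (k : ℕ) (r : ℝ)
    (x : Fin u → Fin d → ℝ) : unsatGiven p k r x ≤ 1 := measureReal_le_one

lemma norm_unsatGiven_le {d u : ℕ} (p : ℝ≥0∞) [Fact (1 ≤ p)] (k : ℕ) (r : ℝ)
    (x : Fin u → Fin d → ℝ) : ‖unsatGiven p k r x‖ ≤ 1 := by
  rw [Real.norm_of_nonneg (unsatGiven_nonneg p k r x)]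
  exact unsatGiven_le_one p k r x

lemma measurable_unsatGiven {d u : ℕ} (p : ℝ≥0∞) [Fact (1 ≤ p)] (k : ℕ) (r : ℝ) :
    Measurable (unsatGiven (d := d) (u := u) p k r) :=
  (measurable_measure_prodMk_left (ν := signsLaw u k)
    (measurableSet_satisfiable (d := d) (n := u) (k := k) p r).compl).ennreal_toReal

lemma probUnsat_eq_integral (p : ℝ≥0∞) [Fact (1 ≤ p)] (d k u : ℕ) (r : ℝ) :
    probUnsat p d k u r = ∫ x, unsatGiven p k r x ∂pointsLaw d u := by
  have hs := (measurableSet_satisfiable (d := d) (n := u) (k := k) p r).compl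
  rw [integral_eq_lintegral_of_nonneg_ae (Eventually.of_forall (unsatGiven_nonneg p k r))
    (measurable_unsatGiven p k r).aestronglyMeasurable]
  change ((law d u k) _).toReal = _
  rw [← Set.compl_ofPred, Measure.prod_apply hs]
  congr 1
  refine lintegral_congr fun x => ?_
  exact (ENNReal.ofReal_toReal (measure_ne_top _ _)).symm

lemma inCommonBall_smul_add {d u : ℕ} {p : ℝ≥0∞} [Fact (1 ≤ p)] {r : ℝ} (hr : 0 < r)
    (a : Fin d → ℝ) (z : Fin u → Fin d → ℝ) (s : Finset (Fin u)) :
    InCommonBall p r (fun i => a + r • z i) s ↔ InCommonBall p 1 z s := by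
  have key : ∀ (c : PiLp p fun _ : Fin d => ℝ) (i : Fin u),
      WithLp.toLp p (a + r • z i) ∈ Metric.closedBall (WithLp.toLp p a + r • c) r ↔
        WithLp.toLp p (z i) ∈ Metric.closedBall c 1 := by
    intro c i
    rw [WithLp.toLp_add, WithLp.toLp_smul, Metric.mem_closedBall, Metric.mem_closedBall,
      dist_add_left, dist_smul₀, Real.norm_of_nonneg hr.le]
    exact mul_le_iff_le_one_right hr
  constructor
  · rintro ⟨c, hc⟩
    refine ⟨r⁻¹ • (c - WithLp.toLp p a), fun i hi => (key _ i).1 ?_⟩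
    rw [smul_inv_smul₀ hr.ne', add_sub_cancel]
    exact hc i hi
  · rintro ⟨c, hc⟩
    exact ⟨_, fun i hi => (key c i).2 (hc i hi)⟩

lemma unsatGiven_smul_add {d u : ℕ} (p : ℝ≥0∞) [Fact (1 ≤ p)] (k : ℕ) {r : ℝ} (hr : 0 < r)
    (a : Fin d → ℝ) (z : Fin u → Fin d → ℝ) :
    unsatGiven p k r (fun i => a + r • z i) = unsatGiven p k 1 z := by
  simp only [unsatGiven, formula, inCommonBall_smul_add hr]

lemma dist_le_of_unsatGiven_ne_zero {d m k : ℕ} {p : ℝ≥0∞} [Fact (1 ≤ p)] (hm : U k = m + 1)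
    {z : Fin (m + 1) → Fin d → ℝ} (h : unsatGiven p k 1 z ≠ 0) (i j : Fin (m + 1)) :
    dist (z i) (z j) ≤ 2 * (m + 1) := by
  obtain ⟨σ, hσ⟩ : {σ : Signs (m + 1) k | ¬ Satisfiable (formula p 1 z σ)}.Nonempty := by
    rw [Set.nonempty_iff_ne_empty]
    intro h0
    rw [unsatGiven, h0, measureReal_empty] at h
    exact h rfl
  rw [Set.mem_ofPred_eq, satisfiable_formula_iff] at hσ
  have := (linked_of_card_eq_U hσ (by simp [hm])).dist_le (by norm_num) (Finset.mem_univ j)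
    (Finset.mem_univ i)
  simp at this
  linarith

lemma signsLaw_singleton_pos {n k : ℕ} (σ : Signs n k) : 0 < (signsLaw n k).real {σ} := by
  rw [measureReal_def, ENNReal.toReal_pos_iff]
  refine ⟨?_, measure_lt_top _ _⟩
  rw [signsLaw, Measure.pi_singleton, pos_iff_ne_zero, Finset.prod_ne_zero_iff]
  intro s _
  rw [PMF.toMeasure_apply_singleton _ _ (measurableSet_singleton _), PMF.uniformOfFintype_apply]
  simp

lemma exists_le_unsatGiven {d m k : ℕ} (p : ℝ≥0∞) [Fact (1 ≤ p)] (hk : 2 ≤ k)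
    (hm : U k = m + 1) : ∃ c > 0, ∀ z : Fin (m + 1) → Fin d → ℝ,
      InCommonBall p 1 z Finset.univ → c ≤ unsatGiven p k 1 z := by
  obtain ⟨σ, hσ⟩ : ∃ σ : Signs (m + 1) k, ∀ x : Fin (m + 1) → Fin d → ℝ,
      InCommonBall p 1 x Finset.univ → ¬ Satisfiable (formula p 1 x σ) :=
    hm ▸ exists_signs_not_satisfiable (d := d) hk (p := p) (r := 1)
  exact ⟨_, signsLaw_singleton_pos σ, fun z hz =>
    measureReal_mono (Set.singleton_subset_iff.2 (hσ z hz))⟩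

/-! ### The probability that `U k` given variables are contradictory, for small radii -/

/-- The integral over all shapes of configurations of `m + 1` points at radius one, one of them
being at the origin, of the conditional probability that the formula on them is unsatisfiable. -/
noncomputable def shapeIntegral (p : ℝ≥0∞) [Fact (1 ≤ p)] (d k m : ℕ) : ℝ :=
  ∫ z : Fin m → Fin d → ℝ,
    unsatGiven p k 1 (Fin.cons 0 z : Fin (m + 1) → Fin d → ℝ)

lemma measurable_cons {d m : ℕ} : Measurable fun z : (Fin d → ℝ) × (Fin m → Fin d → ℝ) =>
    (Fin.cons z.1 z.2 : Fin (m + 1) → Fin d → ℝ) := by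
  refine measurable_pi_lambda _ fun i => ?_
  refine Fin.cases ?_ (fun j => ?_) i
  · simpa using measurable_fst
  · simpa using! (measurable_pi_apply j).comp measurable_snd

lemma integrable_unsatGiven_cons {d m k : ℕ} (p : ℝ≥0∞) [Fact (1 ≤ p)] (hm : U k = m + 1) :
    Integrable fun z : Fin m → Fin d → ℝ =>
      unsatGiven p k 1 (Fin.cons 0 z : Fin (m + 1) → Fin d → ℝ) := by
  have hb : Integrable ((Metric.closedBall (0 : Fin m → Fin d → ℝ) (2 * (m + 1))).indicator
      fun _ => (1 : ℝ)) :=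
    (integrable_indicator_iff Metric.isClosed_closedBall.measurableSet).2
      (integrableOn_const (by exact measure_closedBall_lt_top.ne))
  refine hb.mono' ((measurable_unsatGiven p k 1).comp
    (measurable_cons.comp (measurable_const.prodMk measurable_id))).aestronglyMeasurable
    (Eventually.of_forall fun z => ?_)
  by_cases hz : unsatGiven p k 1 (Fin.cons 0 z : Fin (m + 1) → Fin d → ℝ) = 0
  · rw [hz, norm_zero]
    exact Set.indicator_nonneg (fun _ _ => zero_le_one) _
  · rw [Set.indicator_of_mem]
    · exact norm_unsatGiven_le _ _ _ _
    · rw [Metric.mem_closedBall, dist_pi_le_iff (by positivity)]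
      intro i
      simpa using dist_le_of_unsatGiven_ne_zero hm hz i.succ 0

lemma shapeIntegral_pos {d m k : ℕ} (p : ℝ≥0∞) [Fact (1 ≤ p)] (hk : 2 ≤ k)
    (hm : U k = m + 1) : 0 < shapeIntegral p d k m := by
  obtain ⟨c, hc, hle⟩ := exists_le_unsatGiven (d := d) p hk hm
  have hopen : IsOpen (WithLp.toLp p ⁻¹' Metric.ball (0 : PiLp p fun _ : Fin d => ℝ) 1) :=
    Metric.isOpen_ball.preimage (PiLp.continuous_toLp p _)
  set O : Set (Fin m → Fin d → ℝ) :=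
    Set.univ.pi fun _ => WithLp.toLp p ⁻¹' Metric.ball (0 : PiLp p fun _ : Fin d => ℝ) 1 with hO
  have hOo : IsOpen O := isOpen_set_pi Set.finite_univ fun _ _ => hopen
  have hpos : 0 < volume O := hOo.measure_pos _ ⟨0, fun i _ => by simp⟩
  rw [shapeIntegral, integral_pos_iff_support_of_nonneg
    (fun z => unsatGiven_nonneg _ _ _ _) (integrable_unsatGiven_cons p hm)]
  refine hpos.trans_le (measure_mono fun z hz => ?_)
  refine (hc.trans_le (hle _ ⟨0, fun i _ => ?_⟩)).ne'
  refine Fin.cases ?_ (fun j => ?_) i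
  · simp
  · exact Metric.ball_subset_closedBall (hz j (Set.mem_univ j))

/-- The substitution `y = a + r z` for the last `m` points, where `a` is the first of the points. -/
lemma probUnsat_eq_pow_mul {d m k : ℕ} (p : ℝ≥0∞) [Fact (1 ≤ p)] {r : ℝ} (hr : 0 < r) :
    probUnsat p d k (m + 1) r = r ^ (m * d) *
      ∫ a in (Set.Icc 0 1 : Set (Fin d → ℝ)), ∫ z : Fin m → Fin d → ℝ,
        {z : Fin m → Fin d → ℝ | ∀ i, a + r • z i ∈ Set.Icc (0 : Fin d → ℝ) 1}.indicator
          (fun z => unsatGiven p k 1 (Fin.cons 0 z : Fin (m + 1) → Fin d → ℝ)) z := by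
  let μ : Measure (Fin d → ℝ) := volume.restrict (Set.Icc 0 1)
  have hmp := (measurePreserving_piFinSuccAbove (fun _ : Fin (m + 1) => μ) 0).symm
  have hcube : Measure.pi (fun _ : Fin m => μ) =
      volume.restrict (Set.univ.pi fun _ : Fin m => Set.Icc (0 : Fin d → ℝ) 1) := by
    rw [volume_pi, Measure.restrict_pi_pi]
  have hcm : MeasurableSet (Set.univ.pi fun _ : Fin m => Set.Icc (0 : Fin d → ℝ) 1) :=
    MeasurableSet.univ_pi fun _ => measurableSet_Icc
  rw [probUnsat_eq_integral, pointsLaw, ← hmp.integral_comp']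
  have hcons : ∀ z : (Fin d → ℝ) × (Fin m → Fin d → ℝ),
      (MeasurableEquiv.piFinSuccAbove (fun _ : Fin (m + 1) => Fin d → ℝ) 0).symm z =
        Fin.cons z.1 z.2 := fun z => by
    simp [MeasurableEquiv.piFinSuccAbove_symm_apply]
    rfl
  have hint : Integrable (fun z : (Fin d → ℝ) × (Fin m → Fin d → ℝ) =>
      unsatGiven p k r (Fin.cons z.1 z.2 : Fin (m + 1) → Fin d → ℝ))
      (μ.prod (Measure.pi fun _ => μ)) :=
    Integrable.of_bound ((measurable_unsatGiven p k r).comp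
      measurable_cons).aestronglyMeasurable 1 (Eventually.of_forall fun _ =>
        norm_unsatGiven_le _ _ _ _)
  simp only [hcons]
  rw [integral_prod _ hint, ← integral_const_mul]
  refine integral_congr_ae (Eventually.of_forall fun a => ?_)
  simp only
  rw [hcube, ← integral_indicator hcm, ← integral_add_left_eq_self _ (fun _ => a)]
  have h := Measure.integral_comp_smul_of_nonneg (volume : Measure (Fin m → Fin d → ℝ))
    (fun y => (Set.univ.pi fun _ : Fin m => Set.Icc (0 : Fin d → ℝ) 1).indicator
      (fun y => unsatGiven p k r (Fin.cons a y : Fin (m + 1) → Fin d → ℝ)) ((fun _ => a) + y))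
    r (hR := hr.le)
  have hfr : Module.finrank ℝ (Fin m → Fin d → ℝ) = m * d := by
    rw [Module.finrank_pi_fintype]
    simp
  rw [hfr, smul_eq_mul, eq_comm, inv_mul_eq_iff_eq_mul₀ (pow_pos hr _).ne'] at h
  rw [h]
  congr 1
  refine integral_congr_ae (Eventually.of_forall fun z => ?_)
  have hiff : (fun _ => a) + r • z ∈ (Set.univ.pi fun _ : Fin m => Set.Icc (0 : Fin d → ℝ) 1) ↔
      z ∈ {z : Fin m → Fin d → ℝ | ∀ i, a + r • z i ∈ Set.Icc (0 : Fin d → ℝ) 1} := by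
    simp only [Set.mem_univ_pi]
    rfl
  simp only
  by_cases hz : z ∈ {z : Fin m → Fin d → ℝ | ∀ i, a + r • z i ∈ Set.Icc (0 : Fin d → ℝ) 1}
  · rw [Set.indicator_of_mem hz, Set.indicator_of_mem (hiff.2 hz),
      ← unsatGiven_smul_add p k hr a]
    congr 1
    ext i : 1
    refine Fin.cases ?_ (fun j => ?_) i
    · simp
    · simp
  · rw [Set.indicator_of_notMem hz, Set.indicator_of_notMem (mt hiff.1 hz)]

/-- Boundary effects disappear in the limit: for a first point inside the cube, the other points of
any fixed shape are eventually in the cube as well. -/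
lemma tendsto_probUnsat_div {d m k : ℕ} (p : ℝ≥0∞) [Fact (1 ≤ p)] (hm : U k = m + 1) :
    Tendsto (fun r => probUnsat p d k (m + 1) r / r ^ (m * d)) (𝓝[>] 0)
      (𝓝 (shapeIntegral p d k m)) := by
  set J : ℝ → (Fin d → ℝ) → ℝ := fun r a => ∫ z : Fin m → Fin d → ℝ,
    {z : Fin m → Fin d → ℝ | ∀ i, a + r • z i ∈ Set.Icc (0 : Fin d → ℝ) 1}.indicator
      (fun z => unsatGiven p k 1 (Fin.cons 0 z : Fin (m + 1) → Fin d → ℝ)) z with hJ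
  have hqi := integrable_unsatGiven_cons (d := d) p hm
  have hset : ∀ r : ℝ, MeasurableSet {w : (Fin d → ℝ) × (Fin m → Fin d → ℝ) |
      ∀ i, w.1 + r • w.2 i ∈ Set.Icc (0 : Fin d → ℝ) 1} := by
    intro r
    rw [Set.ofPred_forall]
    refine MeasurableSet.iInter fun i => ?_
    have hmeas : Measurable fun w : (Fin d → ℝ) × (Fin m → Fin d → ℝ) => w.1 + r • w.2 i := by
      fun_prop
    exact hmeas measurableSet_Icc
  have hind : ∀ (r : ℝ) (a : Fin d → ℝ) (z : Fin m → Fin d → ℝ),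
      ‖{z : Fin m → Fin d → ℝ | ∀ i, a + r • z i ∈ Set.Icc (0 : Fin d → ℝ) 1}.indicator
        (fun z => unsatGiven p k 1 (Fin.cons 0 z : Fin (m + 1) → Fin d → ℝ)) z‖ ≤
      unsatGiven p k 1 (Fin.cons 0 z : Fin (m + 1) → Fin d → ℝ) := by
    intro r a z
    refine (norm_indicator_le_norm_self _ _).trans ?_
    rw [Real.norm_of_nonneg (unsatGiven_nonneg _ _ _ _)]
  have hJm : ∀ r, StronglyMeasurable (J r) := by
    intro r
    have hmeas : Measurable ({w : (Fin d → ℝ) × (Fin m → Fin d → ℝ) |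
      ∀ i, w.1 + r • w.2 i ∈ Set.Icc (0 : Fin d → ℝ) 1}.indicator
        fun w => unsatGiven p k 1 (Fin.cons 0 w.2 : Fin (m + 1) → Fin d → ℝ)) :=
      ((measurable_unsatGiven p k 1).comp
        (measurable_cons.comp (measurable_const.prodMk measurable_snd))).indicator (hset r)
    exact hmeas.stronglyMeasurable.integral_prod_right' (ν := volume)
  have hlim : ∀ᵐ a ∂(volume : Measure (Fin d → ℝ)).restrict (Set.Icc 0 1),
      Tendsto (fun r => J r a) (𝓝[>] 0) (𝓝 (shapeIntegral p d k m)) := by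
    have hae : (volume : Measure (Fin d → ℝ)).restrict (Set.Icc 0 1) =
        volume.restrict (Set.univ.pi fun _ => Set.Ioo 0 1) :=
      (Measure.restrict_congr_set (Measure.univ_pi_Ioo_ae_eq_Icc (f := 0) (g := 1))).symm
    rw [hae]
    have hopen : IsOpen (Set.univ.pi fun _ : Fin d => Set.Ioo (0 : ℝ) 1) :=
      isOpen_set_pi Set.finite_univ fun _ _ => isOpen_Ioo
    have hsub : (Set.univ.pi fun _ : Fin d => Set.Ioo (0 : ℝ) 1) ⊆ Set.Icc 0 1 := fun y hy =>
      ⟨fun i => (hy i (Set.mem_univ i)).1.le, fun i => (hy i (Set.mem_univ i)).2.le⟩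
    filter_upwards [ae_restrict_mem hopen.measurableSet] with a ha
    -- Dominated convergence in the shape `z`, for a fixed interior point `a`.
    refine tendsto_integral_filter_of_dominated_convergence _ ?_ ?_ hqi ?_
    · refine Eventually.of_forall fun r => (hqi.aestronglyMeasurable.indicator ?_)
      exact (measurable_const.prodMk measurable_id) (hset r)
    · exact Eventually.of_forall fun r => Eventually.of_forall fun z => hind r a z
    · refine Eventually.of_forall fun z => ?_
      have hev : ∀ᶠ r in 𝓝[>] (0 : ℝ), ∀ i, a + r • z i ∈ Set.Icc (0 : Fin d → ℝ) 1 := by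
        rw [eventually_all]
        intro i
        have hc : ContinuousAt (fun r : ℝ => a + r • z i) 0 := by fun_prop
        have : ∀ᶠ r in 𝓝 (0 : ℝ), a + r • z i ∈ Set.univ.pi fun _ : Fin d => Set.Ioo (0 : ℝ) 1 :=
          hc.eventually_mem (hopen.mem_nhds (by simpa using ha))
        exact (this.mono fun r hr => hsub hr).filter_mono nhdsWithin_le_nhds
      refine tendsto_const_nhds.congr' (hev.mono fun r hr => ?_)
      simp only
      rw [Set.indicator_of_mem]
      exact hr
  have hJle : ∀ r a, ‖J r a‖ ≤ shapeIntegral p d k m := fun r a =>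
    norm_integral_le_of_norm_le hqi (Eventually.of_forall (hind r a))
  have hmain : Tendsto (fun r => ∫ a in (Set.Icc 0 1 : Set (Fin d → ℝ)), J r a) (𝓝[>] 0)
      (𝓝 (∫ _ in (Set.Icc 0 1 : Set (Fin d → ℝ)), shapeIntegral p d k m)) :=
    tendsto_integral_filter_of_dominated_convergence (fun _ => shapeIntegral p d k m)
      (Eventually.of_forall fun r => (hJm r).aestronglyMeasurable)
      (Eventually.of_forall fun r => Eventually.of_forall fun a => hJle r a)
      (integrable_const _) hlim
  rw [integral_const, probReal_univ, one_smul] at hmain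
  refine hmain.congr' ?_
  filter_upwards [self_mem_nhdsWithin] with r hr
  rw [probUnsat_eq_pow_mul p hr, mul_div_cancel_left₀ _ (pow_pos hr _).ne']

/-! ### Clusters of points are rare -/

/-- The event that the points of `T` are pairwise at distance at most `ρ`. -/
def clusterEvent {d n k : ℕ} (ρ : ℝ) (T : Finset (Fin n)) :
    Set ((Fin n → Fin d → ℝ) × Signs n k) :=
  {ω | ∀ a ∈ T, ∀ b ∈ T, dist (ω.1 a) (ω.1 b) ≤ ρ}

lemma measurableSet_setOf_dist_le {d n : ℕ} (ρ : ℝ) (a b : Fin n) :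
    MeasurableSet {x : Fin n → Fin d → ℝ | dist (x a) (x b) ≤ ρ} :=
  (isClosed_le (by fun_prop) continuous_const).measurableSet

/-- Given one of the `m + 1` points, each other one has to be in a cube of side `2 ρ`. -/
lemma measureReal_clusterEvent_le {d n k m : ℕ} {ρ : ℝ} (hρ : 0 ≤ ρ) {T : Finset (Fin n)}
    (hT : T.card = m + 1) :
    (law d n k).real (clusterEvent ρ T) ≤ (2 * ρ) ^ (m * d) := by
  let e := (T.orderEmbOfFin hT).toEmbedding
  let μ : Measure (Fin d → ℝ) := volume.restrict (Set.Icc 0 1)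
  let E : Set (Fin (m + 1) → Fin d → ℝ) := {x | ∀ i : Fin m, dist (x i.succ) (x 0) ≤ ρ}
  have hE : MeasurableSet E := by
    simp only [E, Set.ofPred_forall]
    exact MeasurableSet.iInter fun i => measurableSet_setOf_dist_le ρ _ _
  have hmp : MeasurePreserving (fun ω : (Fin n → Fin d → ℝ) × Signs n k => ω.1 ∘ e)
      (law d n k) (pointsLaw d (m + 1)) :=
    measurePreserving_fst.comp (measurePreserving_pull (d := d) (k := k) e)
  have hsub : clusterEvent ρ T ⊆
      (fun ω : (Fin n → Fin d → ℝ) × Signs n k => ω.1 ∘ e) ⁻¹' E := fun ω hω i =>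
    hω _ (Finset.orderEmbOfFin_mem T hT _) _ (Finset.orderEmbOfFin_mem T hT _)
  have hmp' := (measurePreserving_piFinSuccAbove (fun _ : Fin (m + 1) => μ) 0).symm
  have hbound : pointsLaw d (m + 1) E ≤ ENNReal.ofReal ((2 * ρ) ^ (m * d)) := by
    rw [pointsLaw, ← hmp'.measure_preimage hE.nullMeasurableSet,
      Measure.prod_apply (hmp'.measurable hE)]
    calc ∫⁻ a, Measure.pi (fun _ : Fin m => μ) (Prod.mk a ⁻¹'
            ((MeasurableEquiv.piFinSuccAbove (fun _ : Fin (m + 1) => Fin d → ℝ) 0).symm ⁻¹' E)) ∂μ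
        ≤ ∫⁻ _, ENNReal.ofReal ((2 * ρ) ^ (m * d)) ∂μ := by
          refine lintegral_mono fun a => ?_
          have hset : Prod.mk a ⁻¹' ((MeasurableEquiv.piFinSuccAbove
              (fun _ : Fin (m + 1) => Fin d → ℝ) 0).symm ⁻¹' E) =
              Set.univ.pi fun _ => Metric.closedBall a ρ := by
            ext y
            simp [E, MeasurableEquiv.piFinSuccAbove_symm_apply]
          rw [hset, Measure.pi_pi, Finset.prod_const, Finset.card_univ, Fintype.card_fin]
          refine (pow_le_pow_left' (Measure.restrict_apply_le _ _) m).trans_eq ?_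
          rw [Real.volume_pi_closedBall _ hρ, Fintype.card_fin,
            ← ENNReal.ofReal_pow (by positivity), ← pow_mul, mul_comm d m]
      _ = ENNReal.ofReal ((2 * ρ) ^ (m * d)) := by simp
  calc (law d n k).real (clusterEvent ρ T)
      ≤ (law d n k).real ((fun ω : (Fin n → Fin d → ℝ) × Signs n k => ω.1 ∘ e) ⁻¹' E) :=
        measureReal_mono hsub
    _ = (pointsLaw d (m + 1)).real E := hmp.measureReal_preimage hE.nullMeasurableSet
    _ ≤ (2 * ρ) ^ (m * d) := ENNReal.toReal_le_of_le_ofReal (by positivity) hbound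

/-! ### Comparison with the Poisson law for a fixed number of variables -/

/-- The sets of `u` variables that meet `S`. -/
def neighbours {n : ℕ} (u : ℕ) (S : Finset (Fin n)) :
    Finset {T : Finset (Fin n) // T.card = u} :=
  Finset.univ.filter fun T => ¬ Disjoint S T.1

/-- A set of `m + 1` variables meeting `S` is determined by a common element and `m` others. -/
lemma card_neighbours_le {n m : ℕ} (S : Finset (Fin n)) :
    (neighbours (m + 1) S).card ≤ S.card * n ^ m := by
  have hsub : (neighbours (m + 1) S).map (Function.Embedding.subtype _) ⊆
      (S ×ˢ Finset.powersetCard m Finset.univ).image fun q => insert q.1 q.2 := by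
    intro T hT
    obtain ⟨⟨T', hc⟩, hT', rfl⟩ := Finset.mem_map.1 hT
    obtain ⟨v, hvS, hvT⟩ := Finset.not_disjoint_iff.1 (Finset.mem_filter.1 hT').2
    refine Finset.mem_image.2 ⟨(v, T'.erase v), ?_, Finset.insert_erase hvT⟩
    simp [hvS, Finset.mem_powersetCard, Finset.card_erase_of_mem hvT, hc]
  rw [← Finset.card_map (Function.Embedding.subtype _)]
  refine (Finset.card_le_card hsub).trans (Finset.card_image_le.trans ?_)
  rw [Finset.card_product, Finset.card_powersetCard, Finset.card_univ, Fintype.card_fin]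
  exact Nat.mul_le_mul_left _ (Nat.choose_le_pow n m)

/-- The formula is satisfiable exactly when it has no unsatisfiable part on `U k` variables, unless
`U k + 1` points form a cluster. -/
lemma abs_probSat_sub_le {d k n m : ℕ} (p : ℝ≥0∞) [Fact (1 ≤ p)] (hm : U k = m + 1) {r : ℝ}
    (hr : 0 ≤ r) :
    |probSat p d k n r -
        (law d n k).real (⋃ T, badFamily (d := d) (n := n) (k := k) p r (m + 1) T)ᶜ| ≤
      n ^ (m + 2) * (8 * (m + 1) * r) ^ ((m + 1) * d) := by
  set B := (⋃ T, badFamily (d := d) (n := n) (k := k) p r (m + 1) T)ᶜ with hB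
  set Q := {ω : (Fin n → Fin d → ℝ) × Signs n k | Satisfiable (formula p r ω.1 ω.2)} with hQ
  have hsub : Q ⊆ B := by
    intro ω hω
    rw [hB, Set.mem_compl_iff, Set.mem_iUnion]
    rintro ⟨T, hT⟩
    exact hT ((satisfiable_formula_iff.1 hω).mono (Finset.subset_univ _))
  have hcover : B ⊆ Q ∪ ⋃ T ∈ Finset.powersetCard (m + 2) (Finset.univ : Finset (Fin n)),
      clusterEvent (4 * (m + 1) * r) T := by
    intro ω hω
    by_cases hs : ω ∈ Q
    · exact Or.inl hs
    · right
      obtain ⟨T, hTc, hT⟩ := exists_cluster_of_not_satisfiable (by omega) hs fun S hS => by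
        by_contra hbad
        exact hω (Set.mem_iUnion.2 ⟨⟨S, hS.trans hm⟩, hbad⟩)
      refine Set.mem_iUnion₂.2 ⟨T, Finset.mem_powersetCard.2
        ⟨Finset.subset_univ _, by omega⟩, ?_⟩
      rw [hm] at hT
      push_cast at hT
      exact hT
  have h1 : (law d n k).real Q ≤ (law d n k).real B := measureReal_mono hsub
  have h2 : (law d n k).real B ≤ (law d n k).real Q +
      n ^ (m + 2) * (8 * (m + 1) * r) ^ ((m + 1) * d) := by
    refine (measureReal_mono hcover).trans ((measureReal_union_le _ _).trans ?_)
    refine add_le_add le_rfl ((measureReal_biUnion_finset_le _ _).trans ?_)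
    refine (Finset.sum_le_card_nsmul _ _ ((8 * (m + 1) * r) ^ ((m + 1) * d))
      fun T hT => ?_).trans ?_
    · refine (measureReal_clusterEvent_le (by positivity)
        (Finset.mem_powersetCard.1 hT).2).trans_eq ?_
      ring
    · rw [nsmul_eq_mul, Finset.card_powersetCard, Finset.card_univ, Fintype.card_fin]
      refine mul_le_mul_of_nonneg_right ?_ (by positivity)
      exact_mod_cast Nat.choose_le_pow n (m + 2)
  change |(law d n k).real Q - _| ≤ _
  rw [abs_le]
  constructor <;> linarith

/-- The Poisson approximation for the number of unsatisfiable parts on `U k` variables. Of two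
overlapping parts, one extends by a variable of the other to a cluster of `U k + 1` points. -/
lemma abs_probNoBad_sub_exp_le {d k n m : ℕ} (p : ℝ≥0∞) [Fact (1 ≤ p)] (hk : 0 < k)
    (hm : U k = m + 1) {r : ℝ} (hr : 0 ≤ r) :
    |(law d n k).real (⋃ T, badFamily (d := d) (n := n) (k := k) p r (m + 1) T)ᶜ -
        Real.exp (-(n.choose (m + 1) * probUnsat p d k (m + 1) r))| ≤
      n ^ (m + 1) * (probUnsat p d k (m + 1) r *
        ((m + 1) * n ^ m * probUnsat p d k (m + 1) r)) +
      n ^ (m + 1) * (n * (8 * (m + 1) * r) ^ ((m + 1) * d)) := by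
  set q := probUnsat p d k (m + 1) r with hq
  have hq0 : 0 ≤ q := measureReal_nonneg
  have hprob : ∀ T, (law d n k).real (badFamily p r (m + 1) T) = q := fun T =>
    measureReal_badEvent p r T.2
  have hcardle : ∀ c : ℝ, 0 ≤ c →
      (Fintype.card {T : Finset (Fin n) // T.card = m + 1}) • c ≤ n ^ (m + 1) * c := by
    intro c hc
    rw [Fintype.card_finset_len, Fintype.card_fin, nsmul_eq_mul]
    refine mul_le_mul_of_nonneg_right ?_ hc
    exact_mod_cast Nat.choose_le_pow n (m + 1)
  have hmain := abs_measureReal_compl_iUnion_sub_exp_le (μ := law d n k)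
    (measurableSet_badFamily (d := d) (n := n) (k := k) p r (m + 1))
    (N := fun T => neighbours (m + 1) T.1)
    (fun T => Finset.mem_filter.2 ⟨Finset.mem_univ _, by
      rw [disjoint_self, Finset.bot_eq_empty, ← Finset.card_eq_zero, T.2]
      exact Nat.succ_ne_zero m⟩)
    (fun T h hb => setIntegral_badEvent_countEvents hk p r T.1 _ (fun T' hT' => by
      simpa [neighbours] using hT') h hb)
  have hsum : ∑ T, (law d n k).real (badFamily p r (m + 1) T) = n.choose (m + 1) * q := by
    rw [Finset.sum_congr rfl fun T _ => hprob T, Finset.sum_const, Finset.card_univ,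
      Fintype.card_finset_len, Fintype.card_fin, nsmul_eq_mul]
  rw [hsum] at hmain
  refine hmain.trans (add_le_add ?_ ?_)
  · refine (Finset.sum_le_card_nsmul _ _ (q * ((m + 1) * n ^ m * q)) fun T _ => ?_).trans
      (hcardle _ (by positivity))
    rw [hprob]
    refine mul_le_mul_of_nonneg_left ?_ hq0
    refine (measureReal_biUnion_finset_le _ _).trans ?_
    rw [Finset.sum_congr rfl fun T _ => hprob T, Finset.sum_const, nsmul_eq_mul]
    refine mul_le_mul_of_nonneg_right ?_ hq0
    have := card_neighbours_le (m := m) T.1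
    rw [T.2] at this
    exact_mod_cast this
  · refine (Finset.sum_le_card_nsmul _ _ (n * (8 * (m + 1) * r) ^ ((m + 1) * d))
      fun T _ => ?_).trans (hcardle _ (by positivity))
    have hsub : badFamily (d := d) (k := k) p r (m + 1) T ∩
        ⋃ T' ∈ (neighbours (m + 1) T.1).erase T, badFamily (d := d) (k := k) p r (m + 1) T' ⊆
        ⋃ v ∈ T.1ᶜ, clusterEvent (4 * (m + 1) * r) (insert v T.1) := by
      rintro ω ⟨hT, hω⟩
      obtain ⟨T', hT', hω'⟩ := Set.mem_iUnion₂.1 hω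
      obtain ⟨hne, hnb⟩ := Finset.mem_erase.1 hT'
      obtain ⟨v, hv, hcl⟩ := exists_cluster_of_overlap hr hT hω' (T.2.trans hm.symm)
        (T'.2.trans hm.symm) (fun h => hne (Subtype.ext h)) (Finset.mem_filter.1 hnb).2
      refine Set.mem_biUnion (Finset.mem_coe.2 (Finset.mem_compl.2 hv)) ?_
      rw [hm] at hcl
      push_cast at hcl
      exact hcl
    refine (measureReal_mono hsub (measure_ne_top _ _)).trans
      ((measureReal_biUnion_finset_le _ _).trans ?_)
    refine (Finset.sum_le_card_nsmul _ _ ((8 * (m + 1) * r) ^ ((m + 1) * d))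
      fun v hv => ?_).trans ?_
    · refine (measureReal_clusterEvent_le (m := m + 1) (by positivity) ?_).trans_eq ?_
      · rw [Finset.card_insert_of_notMem (Finset.mem_compl.1 hv), T.2]
      · ring
    · rw [nsmul_eq_mul]
      refine mul_le_mul_of_nonneg_right ?_ (by positivity)
      exact_mod_cast (Finset.card_le_univ _).trans_eq (Fintype.card_fin n)

/-! ### The limit in the critical window -/

/-- The radius at which the expected number of unsatisfiable parts on `m + 1` variables is of
constant order. -/
noncomputable def critRadius (d m : ℕ) (γ : ℝ) (n : ℕ) : ℝ :=
  γ * (n : ℝ) ^ (-(((m : ℝ) + 1) / (d * m)))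

lemma critRadius_nonneg {d m : ℕ} {γ : ℝ} (hγ : 0 ≤ γ) (n : ℕ) : 0 ≤ critRadius d m γ n :=
  mul_nonneg hγ (Real.rpow_nonneg n.cast_nonneg _)

lemma pow_mul_critRadius_pow {d m : ℕ} (γ : ℝ) {n : ℕ} (hn : 0 < n) (a b : ℕ) :
    (n : ℝ) ^ a * critRadius d m γ n ^ b =
      γ ^ b * (n : ℝ) ^ ((a : ℝ) - ((m : ℝ) + 1) / (d * m) * b) := by
  have hn' : (0 : ℝ) < n := Nat.cast_pos.2 hn
  rw [critRadius, mul_pow, ← Real.rpow_mul_natCast hn'.le, sub_eq_add_neg, Real.rpow_add hn',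
    Real.rpow_natCast, neg_mul]
  ring

lemma tendsto_critRadius {d m : ℕ} (hd : 0 < d) (hm : 0 < m) {γ : ℝ} (hγ : 0 < γ) :
    Tendsto (critRadius d m γ) atTop (𝓝[>] 0) := by
  have hd' : (0 : ℝ) < d := Nat.cast_pos.2 hd
  have hm' : (0 : ℝ) < m := Nat.cast_pos.2 hm
  refine tendsto_nhdsWithin_iff.2 ⟨?_, ?_⟩
  · have h := ((tendsto_rpow_neg_atTop (y := ((m : ℝ) + 1) / (d * m)) (by positivity)).comp
      tendsto_natCast_atTop_atTop).const_mul γ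
    rwa [mul_zero] at h
  · filter_upwards [eventually_gt_atTop 0] with n hn
    exact mul_pos hγ (Real.rpow_pos_of_pos (Nat.cast_pos.2 hn) _)

lemma tendsto_pow_mul_probUnsat {d k m : ℕ} (p : ℝ≥0∞) [Fact (1 ≤ p)] (hd : 0 < d) (hm0 : 0 < m)
    (hm : U k = m + 1) {γ : ℝ} (hγ : 0 < γ) :
    Tendsto (fun n : ℕ => (n : ℝ) ^ (m + 1) * probUnsat p d k (m + 1) (critRadius d m γ n)) atTop
      (𝓝 (γ ^ (m * d) * shapeIntegral p d k m)) := by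
  have hd' : (d : ℝ) ≠ 0 := Nat.cast_ne_zero.2 hd.ne'
  have hm' : (m : ℝ) ≠ 0 := Nat.cast_ne_zero.2 hm0.ne'
  have h := ((tendsto_probUnsat_div (d := d) p hm).comp
    (tendsto_critRadius hd hm0 hγ)).const_mul (γ ^ (m * d))
  refine h.congr' ?_
  filter_upwards [eventually_gt_atTop 0] with n hn
  have hpos : 0 < critRadius d m γ n :=
    mul_pos hγ (Real.rpow_pos_of_pos (Nat.cast_pos.2 hn) _)
  have hpow : (n : ℝ) ^ (m + 1) * critRadius d m γ n ^ (m * d) = γ ^ (m * d) := by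
    rw [pow_mul_critRadius_pow γ hn]
    have : ((m + 1 : ℕ) : ℝ) - ((m : ℝ) + 1) / (d * m) * (m * d : ℕ) = 0 := by
      push_cast
      field_simp
      ring
    rw [this, Real.rpow_zero, mul_one]
  rw [← hpow, Function.comp_apply, mul_assoc, mul_div_cancel₀ _ (pow_pos hpos _).ne']

lemma tendsto_pow_mul_critRadius_pow {d m : ℕ} (hd : 0 < d) (hm : 0 < m) (γ : ℝ) :
    Tendsto (fun n : ℕ => (n : ℝ) ^ (m + 2) * critRadius d m γ n ^ ((m + 1) * d)) atTop (𝓝 0) := by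
  have hd' : (d : ℝ) ≠ 0 := Nat.cast_ne_zero.2 hd.ne'
  have hm' : (0 : ℝ) < m := Nat.cast_pos.2 hm
  have h := ((tendsto_rpow_neg_atTop (y := 1 / (m : ℝ)) (by positivity)).comp
    tendsto_natCast_atTop_atTop).const_mul (γ ^ ((m + 1) * d))
  rw [mul_zero] at h
  refine h.congr' ?_
  filter_upwards [eventually_gt_atTop 0] with n hn
  rw [pow_mul_critRadius_pow γ hn, Function.comp_apply]
  congr 2
  push_cast
  field_simp
  ring

/-- The limiting probability of satisfiability: that of no event of a Poisson law. -/
noncomputable def limitProb (p : ℝ≥0∞) [Fact (1 ≤ p)] (d k m : ℕ) (γ : ℝ) : ℝ :=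
  Real.exp (-(γ ^ (m * d) * shapeIntegral p d k m / (m + 1).factorial))

lemma tendsto_probSat {d k m : ℕ} (p : ℝ≥0∞) [Fact (1 ≤ p)] (hk : 0 < k) (hd : 0 < d)
    (hm0 : 0 < m) (hm : U k = m + 1) {γ : ℝ} (hγ : 0 < γ) :
    Tendsto (fun n : ℕ => probSat p d k n (critRadius d m γ n)) atTop
      (𝓝 (limitProb p d k m γ)) := by
  set q : ℕ → ℝ := fun n => probUnsat p d k (m + 1) (critRadius d m γ n) with hq
  have ha := tendsto_pow_mul_probUnsat p hd hm0 hm hγ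
  have hmean : Tendsto (fun n : ℕ => n.choose (m + 1) * q n) atTop
      (𝓝 (γ ^ (m * d) * shapeIntegral p d k m / (m + 1).factorial)) := by
    refine ((isEquivalent_choose (m + 1)).mul
      (Asymptotics.IsEquivalent.refl (u := q))).symm.tendsto_nhds ?_
    refine (ha.div_const _).congr fun n => ?_
    simp only [Pi.mul_apply]
    ring
  have herr : Tendsto (fun n : ℕ => (m + 1) * ((n : ℝ) ^ (m + 1) * q n) ^ 2 * (n : ℝ)⁻¹ +
      2 * (8 * (m + 1)) ^ ((m + 1) * d) *
        ((n : ℝ) ^ (m + 2) * critRadius d m γ n ^ ((m + 1) * d))) atTop (𝓝 0) := by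
    have h1 := ((ha.pow 2).const_mul ((m : ℝ) + 1)).mul
      (tendsto_inv_atTop_zero.comp (tendsto_natCast_atTop_atTop (R := ℝ)))
    have h2 := (tendsto_pow_mul_critRadius_pow hd hm0 γ).const_mul
      (2 * (8 * ((m : ℝ) + 1)) ^ ((m + 1) * d))
    have h3 := h1.add h2
    rw [mul_zero, mul_zero, add_zero] at h3
    exact h3
  have hdiff : Tendsto (fun n : ℕ => probSat p d k n (critRadius d m γ n) -
      Real.exp (-(n.choose (m + 1) * q n))) atTop (𝓝 0) := by
    refine squeeze_zero_norm' ?_ herr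
    filter_upwards [eventually_gt_atTop 0] with n hn
    have hn' : (n : ℝ) ≠ 0 := Nat.cast_ne_zero.2 hn.ne'
    have h1 := abs_probSat_sub_le (d := d) (n := n) p hm
      (critRadius_nonneg (d := d) (m := m) hγ.le n)
    have h2 := abs_probNoBad_sub_exp_le (d := d) (n := n) p hk hm
      (critRadius_nonneg (d := d) (m := m) hγ.le n)
    refine (abs_sub_le _ _ _).trans ((add_le_add h1 h2).trans_eq ?_)
    rw [mul_pow (8 * ((m : ℝ) + 1))]
    simp only [hq]
    field_simp
    ring
  have h := hdiff.add ((Real.continuous_exp.tendsto _).comp hmean.neg)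
  rw [zero_add] at h
  refine h.congr fun n => ?_
  simp

lemma limitProb_pos (p : ℝ≥0∞) [Fact (1 ≤ p)] (d k m : ℕ) (γ : ℝ) :
    0 < limitProb p d k m γ := Real.exp_pos _

lemma limitProb_lt_one {d k m : ℕ} (p : ℝ≥0∞) [Fact (1 ≤ p)] (hk : 2 ≤ k) (hm : U k = m + 1)
    {γ : ℝ} (hγ : 0 < γ) : limitProb p d k m γ < 1 := by
  have := shapeIntegral_pos (d := d) p hk hm
  rw [limitProb, Real.exp_lt_one_iff, neg_lt_zero]
  positivity

lemma tendsto_limitProb_zero {d k m : ℕ} (p : ℝ≥0∞) [Fact (1 ≤ p)] (hd : 0 < d) (hm : 0 < m) :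
    Tendsto (limitProb p d k m) (𝓝[>] 0) (𝓝 1) := by
  have hc : Continuous (limitProb p d k m) := by
    unfold limitProb
    fun_prop
  have h := hc.tendsto 0
  have h0 : limitProb p d k m 0 = 1 := by
    rw [limitProb, zero_pow (Nat.mul_pos hm hd).ne']
    simp
  rw [h0] at h
  exact h.mono_left nhdsWithin_le_nhds

lemma tendsto_limitProb_atTop {d k m : ℕ} (p : ℝ≥0∞) [Fact (1 ≤ p)] (hk : 2 ≤ k) (hd : 0 < d)
    (hm0 : 0 < m) (hm : U k = m + 1) : Tendsto (limitProb p d k m) atTop (𝓝 0) := by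
  have hpos := shapeIntegral_pos (d := d) p hk hm
  refine Real.tendsto_exp_neg_atTop_nhds_zero.comp ?_
  exact ((tendsto_pow_atTop (Nat.mul_pos hm0 hd).ne').atTop_mul_const hpos).atTop_div_const
    (by positivity)

/-! ### The threshold is not sharp -/

/-- If all sequences satisfying a satisfiable pointwise constraint have the limit `L`, then a
sequence with another limit violates the constraint from some point on. -/
lemma eventually_not_of_tendsto_ne {f : ℕ → ℝ → ℝ} {C : ℕ → ℝ → Prop} {L L' : ℝ}
    (hf : ∀ r : ℕ → ℝ, (∀ n, C n (r n)) → Tendsto (fun n => f n (r n)) atTop (𝓝 L))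
    {s ρ : ℕ → ℝ} (hs : ∀ n, C n (s n)) (hρ : Tendsto (fun n => f n (ρ n)) atTop (𝓝 L'))
    (hne : L' ≠ L) : ∀ᶠ n in atTop, ¬ C n (ρ n) := by
  classical
  by_contra hcon
  have hfr : ∃ᶠ n in atTop, n ∈ {n | C n (ρ n)} := by
    rw [not_eventually] at hcon
    exact hcon.mono fun n hn => not_not.1 hn
  have := frequently_mem_iff_neBot.1 hfr
  -- Where the constraint fails for `ρ`, use a value that satisfies it.
  have h := hf (fun n => if C n (ρ n) then ρ n else s n) fun n => by
    split_ifs with hn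
    · exact hn
    · exact hs n
  refine hne (tendsto_nhds_unique (hρ.mono_left inf_le_left)
    ((h.mono_left (inf_le_left (b := 𝓟 {n | C n (ρ n)}))).congr' ?_))
  filter_upwards [mem_inf_of_right (mem_principal_self _)] with n hn
  rw [if_pos hn]

/-- A sharp threshold would lie, eventually, between the multiples `1 / (1 + ε)` and `1 / (1 - ε)`
of every radius in the critical window; for `ε = 1 / 2` the radii with `γ = 1` and `γ = 4`
contradict each other. -/
lemma not_hasSharpThreshold {d k : ℕ} (p : ℝ≥0∞) [Fact (1 ≤ p)] {ρ : ℕ → ℝ} {g : ℝ → ℝ}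
    (hρ : ∀ᶠ n in atTop, 0 < ρ n)
    (hg : ∀ γ, 0 < γ → 0 < g γ ∧ g γ < 1 ∧
      Tendsto (fun n => probSat p d k n (γ * ρ n)) atTop (𝓝 (g γ))) :
    ¬ HasSharpThreshold p d k := by
  rintro ⟨rstar, h⟩
  obtain ⟨hlow, hhigh⟩ := h (1 / 2) (by norm_num)
  obtain ⟨-, hg1, hlim1⟩ := hg 1 one_pos
  obtain ⟨hg4, -, hlim4⟩ := hg 4 four_pos
  have h1 := eventually_not_of_tendsto_ne (f := fun n => probSat p d k n)
    (C := fun n x => x < (1 - 1 / 2) * rstar n) hlow (s := fun n => (1 - 1 / 2) * rstar n - 1)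
    (fun n => sub_one_lt _) hlim1 hg1.ne
  have h4 := eventually_not_of_tendsto_ne (f := fun n => probSat p d k n)
    (C := fun n x => (1 + 1 / 2) * rstar n < x) hhigh (s := fun n => (1 + 1 / 2) * rstar n + 1)
    (fun n => lt_add_one _) hlim4 hg4.ne'
  obtain ⟨n, hn, hn1, hn4⟩ := (hρ.and (h1.and h4)).exists
  simp only [not_lt] at hn1 hn4
  linarith

end GeomSAT

theorem mainTheorem6 (p : ℝ≥0∞) [Fact (1 ≤ p)] (hp : p = ⊤ ∨ p = 2)
    (d : ℕ) (hd : 1 ≤ d) (k : ℕ) (hk : 2 ≤ k) :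
    (GeomSAT.unsatSizes k).Nonempty ∧
    (∃ g : ℝ → ℝ,
      (∀ γ : ℝ, 0 < γ →
        0 < g γ ∧ g γ < 1 ∧
        Tendsto (fun n : ℕ => GeomSAT.probSat p d k n
          (γ * (n : ℝ) ^ (-((GeomSAT.U k : ℝ) / ((d : ℝ) * ((GeomSAT.U k : ℝ) - 1))))))
          atTop (𝓝 (g γ))) ∧
      Tendsto g (𝓝[>] 0) (𝓝 1) ∧
      Tendsto g atTop (𝓝 0)) ∧
    ¬ GeomSAT.HasSharpThreshold p d k := by
  obtain ⟨m, hm⟩ : ∃ m, GeomSAT.U k = m + 1 :=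
    ⟨GeomSAT.U k - 1, by have := GeomSAT.le_U hk; omega⟩
  have hm0 : 0 < m := by
    have := GeomSAT.le_U hk
    omega
  have hlim : ∀ γ : ℝ, 0 < γ → 0 < GeomSAT.limitProb p d k m γ ∧
      GeomSAT.limitProb p d k m γ < 1 ∧ Tendsto (fun n : ℕ => GeomSAT.probSat p d k n
        (γ * (n : ℝ) ^ (-((GeomSAT.U k : ℝ) / ((d : ℝ) * ((GeomSAT.U k : ℝ) - 1))))))
        atTop (𝓝 (GeomSAT.limitProb p d k m γ)) := by
    intro γ hγ
    refine ⟨GeomSAT.limitProb_pos p d k m γ, GeomSAT.limitProb_lt_one p hk hm hγ, ?_⟩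
    have h := GeomSAT.tendsto_probSat p (by omega) hd hm0 hm hγ
    simpa only [GeomSAT.critRadius, hm, Nat.cast_add, Nat.cast_one, add_sub_cancel_right] using h
  refine ⟨GeomSAT.unsatSizes_nonempty hk, ⟨GeomSAT.limitProb p d k m, hlim,
    GeomSAT.tendsto_limitProb_zero p hd hm0,
    GeomSAT.tendsto_limitProb_atTop p hk hd hm0 hm⟩, ?_⟩
  refine GeomSAT.not_hasSharpThreshold p ?_ hlim
  filter_upwards [eventually_gt_atTop 0] with n hn
  exact Real.rpow_pos_of_pos (Nat.cast_pos.2 hn) _
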